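/- Let $1<p<\infty$ and let $q$ be the Hölder conjugate exponent of $p$, $\frac1p+\frac1q=1$. The Fock space $\mathcal F^p$ is the space of entire functions $f:\mathbb C\to\mathbb C$ with $$\frac{p}{2}\int_{\mathbb C}|f(z)|^p e^{-\frac{p\pi}{2}|z|^2}\,dA(z)<\infty,$$ where $dA$ is Euclidean area measure. A set $Z\subset\mathbb C$ is a *zero set* for $\mathcal F^p$ if some $f\in\mathcal F^p\setminus\{0\}$ has, counting multiplicities, exactly the zeros $Z$ (that is, $f$ has a simple zero at each point of $Z$ and no other zeros). It is a *uniqueness set* for $\mathcal F^p$ if the only $f\in\mathcal F^p$ vanishing on $Z$ is $f=0$. It is a *uniqueness set with zero excess* for $\mathcal F^p$ if it is a uniqueness set and, for every $w\in Z$, the set $Z\setminus\{w\}$ is a zero set for $\mathcal F^p$. **Theorem.** Let $$\Gamma=\{\pm\sqrt{2n},\ \pm i\sqrt{2n}\ :\ n\ge 1\}\cup\{\pm1\},$$ let $(\delta_\gamma)_{\gamma\in\Gamma}$ and $(\theta_\gamma)_{\gamma\in\Gamma}$ be families of real numbers, and put $\lambda_\gamma=\gamma e^{\delta_\gamma}e^{i\theta_\gamma}$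 and $\Lambda=\{\lambda_\gamma:\gamma\in\Gamma\}$. For $n\ge1$ let $$\Delta_n=\delta_{\sqrt{2n}}+\delta_{-\sqrt{2n}}+\delta_{i\sqrt{2n}}+\delta_{-i\sqrt{2n}}.$$ Suppose that 1. there is $c>0$ such that $|\lambda_\gamma-\lambda_{\gamma'}|\ge c/\min\{|\gamma|,|\gamma'|\}$ for all $\gamma,\gamma'\in\Gamma$ with $\gamma\ne\gamma'$; 2. the families $(\gamma^2\delta_\gamma)_{\gamma\in\Gamma}$ and $(\gamma^2\theta_\gamma)_{\gamma\in\Gamma}$ are bounded; 3. $\displaystyle\limsup_{n\to\infty}\frac{1}{\log n}\Bigl|\sum_{k=1}^{n}\Delta_k\Bigr|<\frac{1}{2\max\{p,q\}}$. Then $\Lambda$ is a uniqueness set with zero excess for $\mathcal F^p$. -/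

import Mathlib

open MeasureTheory Filter

noncomputable section

/-- The Gaussian measure `(β / 2π) exp (-(β / 2) |z|²) dA(z)` on the complex plane. -/
def gaussianMeasureC (β : ℝ) : Measure ℂ :=
  (volume : Measure ℂ).withDensity
    (fun z => ENNReal.ofReal (β / (2 * Real.pi) * Real.exp (-(β / 2) * ‖z‖ ^ 2)))

/-- Membership in the Fock space `F^p`: `f` is entire and `|f|^p` has finite integral against the
Gaussian measure with parameter `p π`. -/
def MemFock (p : ℝ) (f : ℂ → ℂ) : Prop :=
  Differentiable ℂ f ∧ ∫⁻ z, ‖f z‖ₑ ^ p ∂(gaussianMeasureC (p * Real.pi)) < ⊤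

/-- `Z` is a zero set for `F^p`: some nonzero `f` in `F^p` has, counting multiplicities, exactly
the zeros `Z`; since each point of the set `Z` is counted once, `f` has a simple zero at every
point of `Z` and no other zeros. -/
def IsFockZeroSet (p : ℝ) (Z : Set ℂ) : Prop :=
  ∃ f : ℂ → ℂ, MemFock p f ∧ f ≠ 0 ∧
    (∀ z ∈ Z, analyticOrderAt f z = 1) ∧ (∀ z ∉ Z, f z ≠ 0)

/-- `Z` is a uniqueness set for `F^p`: only the zero function of `F^p` vanishes on `Z`. -/
def IsFockUniquenessSet (p : ℝ) (Z : Set ℂ) : Prop :=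
  ∀ f : ℂ → ℂ, MemFock p f → (∀ z ∈ Z, f z = 0) → f = 0

/-- `Z` is a uniqueness set with zero excess for `F^p`: it is a uniqueness set, and it becomes a
zero set when any single one of its points is removed. -/
def IsFockUniquenessSetZeroExcess (p : ℝ) (Z : Set ℂ) : Prop :=
  IsFockUniquenessSet p Z ∧ ∀ w ∈ Z, IsFockZeroSet p (Z \ {w})

/-- The Ascensi–Lyubarskii–Seip sequence `{±√(2n), ±i√(2n) : n ≥ 1} ∪ {±1}`. -/
def alsSet : Set ℂ :=
  {z : ℂ | ∃ n : ℕ, 1 ≤ n ∧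
    (z = (Real.sqrt (2 * n) : ℂ) ∨ z = -(Real.sqrt (2 * n) : ℂ) ∨
      z = Complex.I * (Real.sqrt (2 * n) : ℂ) ∨ z = -(Complex.I * (Real.sqrt (2 * n) : ℂ)))} ∪
  {1, -1}

/-- The perturbed point `γ e^{δ_γ} e^{i θ_γ}`. -/
def perturbedPoint (δ θ : ℂ → ℝ) (γ : ℂ) : ℂ :=
  γ * Complex.exp (δ γ : ℂ) * Complex.exp (Complex.I * (θ γ : ℂ))

/-- `Δ_n`, the sum of `δ_γ` over the four points `γ` of the sequence with `|γ| = √(2n)`. -/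
def alsDelta (δ : ℂ → ℝ) (n : ℕ) : ℝ :=
  δ (Real.sqrt (2 * n) : ℂ) + δ (-(Real.sqrt (2 * n) : ℂ)) +
    δ (Complex.I * (Real.sqrt (2 * n) : ℂ)) + δ (-(Complex.I * (Real.sqrt (2 * n) : ℂ)))

end

/-! For the unperturbed points the product over `±√(2n)`, `±i√(2n)` is Euler's product for
sin(πz²/2)/(πz²/2), and the two points `±1` replace the double zero at 0. Since |z|² - |Im z²| =
(|x| - |y|)², the weighted modulus of such a function is comparable to a constant on bands along the
diagonals |x| = |y| and has Gaussian decay away from them. Membership in the Fock space is thus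
decided by powers of |z| along the diagonals.

Let S be the perturbed product `genFun`. In sectors around the diagonals, which stay away from the
zeros, each linear factor of index n < |z|² gains a factor exp(-δ_γ) in modulus, and all other
errors add up to a bounded exponent. Hence |S| equals exp(π|Im z²|/2) up to constants and a power
between |z|^(-2b) and |z|^(2b), for some b < 1/(2 max{p,q}) (`exists_norm_genFun_bounds`).

Uniqueness: a function f vanishing on Λ is S h with h entire, and h is a polynomial
(`exists_polynomial_quotient`). If h ≠ 0, the weighted modulus of f is at least c|z|^(-2b) along the
diagonals, which is not p-integrable because 2bp ≤ 1 (`not_memFock_of_le_norm`). Zero excess: S/(z -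
w) has weighted size at most C|z|^(2b-1) along the diagonals, which is p-integrable because (1 -
2b)p > 1, that is 2b < 1/q (`memFock_dslope_genFun`).

The delicate point is that h is a polynomial: S has zeros near the axes, so h = f/S is controlled
directly only near the diagonals. Multiplying h by a tail of the product makes it f divided by a
polynomial, which has finite order. Phragmén–Lindelöf then bounds h by order four uniformly in the
tail, next by order two, and finally, in sectors opening up to the diagonals, by a power of |z|. -/

/-! ### Phragmén–Lindelöf in sectors, and entire functions of polynomial growth. -/

/-- Phragmén–Lindelöf in the sector `|arg z| ≤ α`, `α < π / 2`, in logarithmic coordinates. -/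
theorem norm_le_of_sector {H : ℂ → ℂ} {α c A B M : ℝ} (hα : 0 < α) (hα' : α < Real.pi / 2)
    (hc : c < Real.pi / (2 * α)) (hc0 : 0 ≤ c) (hB : 0 ≤ B)
    (hd : DifferentiableOn ℂ H {z | 0 < z.re})
    (hg : ∀ ζ : ℂ, |ζ.im| ≤ α → ‖H (Complex.exp ζ)‖ ≤ A * Real.exp (B * Real.exp (c * ζ.re)))
    (hb : ∀ ζ : ℂ, |ζ.im| = α → ‖H (Complex.exp ζ)‖ ≤ M) {ζ : ℂ} (hζ : |ζ.im| ≤ α) :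
    ‖H (Complex.exp ζ)‖ ≤ M := by
  have hre : ∀ ζ : ℂ, |ζ.im| ≤ α → 0 < (Complex.exp ζ).re := by
    intro ζ h
    rw [Complex.exp_re]
    have := abs_le.1 h
    exact mul_pos (Real.exp_pos _) (Real.cos_pos_of_mem_Ioo ⟨by linarith, by linarith⟩)
  have hdiff : DifferentiableOn ℂ (fun ζ => H (Complex.exp ζ)) (Complex.im ⁻¹' Set.Icc (-α) α) := by
    apply hd.comp Complex.differentiable_exp.differentiableOn
    intro z hz
    exact hre z (abs_le.2 hz)
  have hcl : closure (Complex.im ⁻¹' Set.Ioo (-α) α) ⊆ Complex.im ⁻¹' Set.Icc (-α) α :=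
    closure_minimal (Set.preimage_mono Set.Ioo_subset_Icc_self)
      (isClosed_Icc.preimage Complex.continuous_im)
  -- The exponential map turns the sector into a strip of width `2 α`, whence the critical order `π
  -- / (2 α)`.
  refine PhragmenLindelof.horizontal_strip (a := -α) (b := α) (f := fun ζ => H (Complex.exp ζ))
    (hdiff.mono hcl).diffContOnCl ⟨c, by rwa [show α - -α = 2 * α by ring], B, ?_⟩ ?_ ?_
    (abs_le.1 hζ).1 (abs_le.1 hζ).2
  · apply Asymptotics.IsBigO.of_bound |A|
    apply Filter.eventually_inf_principal.2
    refine Filter.Eventually.of_forall fun z hz => ?_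
    have h1 := hg z (abs_le.2 ⟨hz.1.le, hz.2.le⟩)
    rw [Real.norm_eq_abs, abs_of_pos (Real.exp_pos _)]
    refine h1.trans ?_
    gcongr
    · exact le_abs_self A
    · exact le_abs_self _
  · intro z hz
    exact hb z (by rw [hz, abs_neg, abs_of_pos hα])
  · intro z hz
    exact hb z (by rw [hz, abs_of_pos hα])

/-- Lets the holomorphic function `(1 + z) ^ m` stand in for `(1 + ‖z‖) ^ m`, at the cost of a
factor `2 ^ m`. -/
theorem one_add_norm_le_of_re_nonneg {z : ℂ} (hz : 0 ≤ z.re) : 1 + ‖z‖ ≤ 2 * ‖1 + z‖ := by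
  have h1 : 1 ≤ ‖1 + z‖ := by
    have := Complex.abs_re_le_norm (1 + z)
    simp only [Complex.add_re, Complex.one_re] at this
    exact (by linarith [le_abs_self (1 + z.re)] : (1:ℝ) ≤ |1 + z.re|).trans this
  have h2 : ‖z‖ ≤ ‖1 + z‖ := by
    rw [Complex.norm_def, Complex.norm_def]
    apply Real.sqrt_le_sqrt
    simp only [Complex.normSq_apply, Complex.add_re, Complex.one_re, Complex.add_im, Complex.one_im]
    nlinarith
  linarith

/-- Growth of an entire function in a sector controlled by its growth on the boundary rays. -/
theorem norm_le_of_sector_growth {G : ℂ → ℂ} (hG : Differentiable ℂ G) {α c A B b C : ℝ} {k m : ℕ}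
    (hα : 0 < α) (hα' : α < Real.pi / 2) (hkα : k * α < Real.pi / 2)
    (hc : c < Real.pi / (2 * α)) (hc0 : 0 ≤ c) (hB : 0 ≤ B) (hb0 : 0 ≤ b) (hC : 0 ≤ C)
    (hg : ∀ ζ : ℂ, |ζ.im| ≤ α → ‖G (Complex.exp ζ)‖ ≤ A * Real.exp (B * Real.exp (c * ζ.re)))
    (hb : ∀ ζ : ℂ, |ζ.im| = α → ‖G (Complex.exp ζ)‖ ≤
      C * (1 + Real.exp ζ.re) ^ m * Real.exp (b * Real.exp ζ.re ^ k))
    {ζ : ℂ} (hζ : |ζ.im| ≤ α) :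
    ‖G (Complex.exp ζ)‖ ≤ 2 ^ m * C * (1 + Real.exp ζ.re) ^ m *
      Real.exp (b / Real.cos (k * α) * Real.exp ζ.re ^ k) := by
  set a : ℝ := b / Real.cos (k * α) with ha
  have hk0 : 0 ≤ k * α := by positivity
  have hcos : 0 < Real.cos (k * α) := Real.cos_pos_of_mem_Ioo ⟨by linarith, hkα⟩
  have ha0 : 0 ≤ a := by positivity
  have hre : ∀ ζ : ℂ, |ζ.im| ≤ α → 0 < (Complex.exp ζ).re := by
    intro ζ h
    rw [Complex.exp_re]
    have := abs_le.1 h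
    exact mul_pos (Real.exp_pos _) (Real.cos_pos_of_mem_Ioo ⟨by linarith, by linarith⟩)
  have hnorm : ∀ ζ : ℂ, ‖Complex.exp ζ‖ = Real.exp ζ.re := Complex.norm_exp
  have hpow : ∀ ζ : ℂ, (Complex.exp ζ ^ k).re = Real.exp ζ.re ^ k * Real.cos (k * ζ.im) := by
    intro ζ
    rw [← Complex.exp_nat_mul, Complex.exp_re, ← Real.exp_nat_mul]
    simp
  have hcosle : ∀ ζ : ℂ, |ζ.im| ≤ α → Real.cos (k * α) ≤ Real.cos (k * ζ.im) := by
    intro ζ h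
    rw [← Real.cos_abs (k * ζ.im), abs_mul, Nat.abs_cast]
    apply Real.cos_le_cos_of_nonneg_of_le_pi (by positivity) (by linarith [Real.pi_pos])
    gcongr
  -- As `a cos (k α) = b`, the exponential cancels the growth exactly on the two boundary rays and
  -- has modulus at most 1 inside; the denominator removes the polynomial factor. So `H` is bounded
  -- on the rays.
  set H : ℂ → ℂ := fun z => G z / (1 + z) ^ m * Complex.exp (-(a : ℂ) * z ^ k) with hH
  have hexpn : ∀ z : ℂ, ‖Complex.exp (-(a : ℂ) * z ^ k)‖ = Real.exp (-a * (z ^ k).re) := by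
    intro z
    rw [Complex.norm_exp, show -(a : ℂ) = ((-a : ℝ) : ℂ) by push_cast; ring, Complex.re_ofReal_mul]
  have hHn : ∀ z : ℂ, ‖H z‖ = ‖G z‖ / ‖1 + z‖ ^ m * Real.exp (-a * (z ^ k).re) := by
    intro z
    rw [hH]; simp only [norm_mul, norm_div, norm_pow, hexpn]
  have hd : DifferentiableOn ℂ H {z | 0 < z.re} := by
    intro z hz
    apply DifferentiableAt.differentiableWithinAt
    have hz0 : (1 + z) ^ m ≠ 0 := by
      apply pow_ne_zero
      intro h
      have := congrArg Complex.re h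
      simp only [Complex.add_re, Complex.one_re, Complex.zero_re] at this
      have : 0 < z.re := hz
      linarith
    exact ((hG z).div (by fun_prop) hz0).mul (by fun_prop)
  have hone : ∀ ζ : ℂ, |ζ.im| ≤ α → 1 + Real.exp ζ.re ≤ 2 * ‖1 + Complex.exp ζ‖ := by
    intro ζ h
    rw [← hnorm]
    exact one_add_norm_le_of_re_nonneg (hre ζ h).le
  have hone' : ∀ ζ : ℂ, |ζ.im| ≤ α → 1 ≤ ‖1 + Complex.exp ζ‖ := by
    intro ζ h
    have := Complex.abs_re_le_norm (1 + Complex.exp ζ)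
    simp only [Complex.add_re, Complex.one_re] at this
    have h2 := hre ζ h
    exact (by linarith [le_abs_self (1 + (Complex.exp ζ).re)] :
      (1:ℝ) ≤ |1 + (Complex.exp ζ).re|).trans this
  have key : ‖H (Complex.exp ζ)‖ ≤ 2 ^ m * C := by
    refine norm_le_of_sector (A := A) (B := B) hα hα' hc hc0 hB hd ?_ ?_ hζ
    · intro ζ h
      rw [hHn]
      have h1 : Real.exp (-a * (Complex.exp ζ ^ k).re) ≤ 1 := by
        rw [Real.exp_le_one_iff, hpow]
        have := hcosle ζ h
        have : 0 ≤ a * (Real.exp ζ.re ^ k * Real.cos (k * ζ.im)) := by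
          have : 0 ≤ Real.cos (k * ζ.im) := hcos.le.trans this
          positivity
        linarith
      have h2 : 1 ≤ ‖1 + Complex.exp ζ‖ ^ m := one_le_pow₀ (hone' ζ h)
      calc ‖G (Complex.exp ζ)‖ / ‖1 + Complex.exp ζ‖ ^ m * Real.exp (-a * (Complex.exp ζ ^ k).re)
          ≤ ‖G (Complex.exp ζ)‖ / ‖1 + Complex.exp ζ‖ ^ m * 1 := by gcongr
        _ ≤ ‖G (Complex.exp ζ)‖ := by rw [mul_one]; exact div_le_self (norm_nonneg _) h2
        _ ≤ _ := hg ζ h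
    · intro ζ h
      rw [hHn, hpow]
      have hc' : Real.cos (k * ζ.im) = Real.cos (k * α) := by
        rw [← Real.cos_abs (k * ζ.im), abs_mul, Nat.abs_cast, h]
      have h3 : -a * (Real.exp ζ.re ^ k * Real.cos (k * ζ.im)) = -(b * Real.exp ζ.re ^ k) := by
        rw [hc', ha]; field_simp
      rw [h3, Real.exp_neg]
      have h4 : (1 + Real.exp ζ.re) ^ m ≤ 2 ^ m * ‖1 + Complex.exp ζ‖ ^ m := by
        rw [← mul_pow]; exact pow_le_pow_left₀ (by positivity) (hone ζ h.le) m
      have h5 : 0 < ‖1 + Complex.exp ζ‖ ^ m := pow_pos (by linarith [hone' ζ h.le]) m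
      rw [← div_eq_mul_inv, div_div, div_le_iff₀ (by positivity)]
      calc _ ≤ _ := hb ζ h
        _ ≤ C * (2 ^ m * ‖1 + Complex.exp ζ‖ ^ m) * Real.exp (b * Real.exp ζ.re ^ k) := by gcongr
        _ = _ := by ring
  rw [hHn, hpow] at key
  have h5 : 0 < ‖1 + Complex.exp ζ‖ ^ m := pow_pos (by linarith [hone' ζ hζ]) m
  have h6 : ‖1 + Complex.exp ζ‖ ≤ 1 + Real.exp ζ.re := by
    rw [← hnorm]; exact (norm_add_le _ _).trans (by simp)
  have h7 : -a * (Real.exp ζ.re ^ k * Real.cos (k * ζ.im)) ≥ -(a * Real.exp ζ.re ^ k) := by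
    have : a * (Real.exp ζ.re ^ k * Real.cos (k * ζ.im)) ≤ a * (Real.exp ζ.re ^ k * 1) := by
      gcongr; exact Real.cos_le_one _
    linarith
  have h8 : ‖G (Complex.exp ζ)‖ / ‖1 + Complex.exp ζ‖ ^ m * Real.exp (-(a * Real.exp ζ.re ^ k))
      ≤ 2 ^ m * C := by
    refine le_trans ?_ key
    gcongr
  rw [Real.exp_neg, ← div_eq_mul_inv, div_div, div_le_iff₀ (by positivity)] at h8
  calc _ ≤ _ := h8
    _ ≤ 2 ^ m * C * ((1 + Real.exp ζ.re) ^ m * Real.exp (a * Real.exp ζ.re ^ k)) := by gcongr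
    _ = _ := by ring

/-- An entire function of polynomial growth is a polynomial. -/
theorem exists_polynomial_of_norm_le {N : ℕ} {C : ℝ} {h : ℂ → ℂ} (hd : Differentiable ℂ h)
    (hb : ∀ z, ‖h z‖ ≤ C * (1 + ‖z‖) ^ N) : ∃ P : Polynomial ℂ, ∀ z, h z = P.eval z := by
  induction N generalizing h C with
  | zero =>
    refine ⟨Polynomial.C (h 0), fun z => ?_⟩
    rw [Polynomial.eval_C]
    apply hd.apply_eq_apply_of_bounded
    rw [isBounded_iff_forall_norm_le]
    refine ⟨C, ?_⟩
    rintro _ ⟨z, rfl⟩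
    simpa using hb z
  | succ N ih =>
    -- The divided difference at 0 grows one power slower, which drives the induction.
    have hdd : Differentiable ℂ (dslope h 0) := by
      rw [← differentiableOn_univ]
      exact (Complex.differentiableOn_dslope univ_mem).2 hd.differentiableOn
    have hcont : ContinuousOn (dslope h 0) (Metric.closedBall 0 1) := hdd.continuous.continuousOn
    obtain ⟨K, hK⟩ := (isCompact_closedBall (0:ℂ) 1).exists_bound_of_continuousOn hcont
    have hC : 0 ≤ C := by
      have := (norm_nonneg _).trans (hb 0)
      simpa using this
    have hbd : ∀ z, ‖dslope h 0 z‖ ≤ (|K| + 2 * (C + ‖h 0‖)) * (1 + ‖z‖) ^ N := by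
      intro z
      by_cases hz : ‖z‖ ≤ 1
      · have h1 := hK z (by simpa using hz)
        have h2 : (1:ℝ) ≤ (1 + ‖z‖) ^ N := one_le_pow₀ (by linarith [norm_nonneg z])
        calc ‖dslope h 0 z‖ ≤ |K| + 2 * (C + ‖h 0‖) := by
              have := le_abs_self K
              have := norm_nonneg (h 0)
              linarith
          _ ≤ _ := le_mul_of_one_le_right (by positivity) h2
      · push Not at hz
        have hz0 : z ≠ 0 := by rintro rfl; simp at hz; linarith
        rw [dslope_of_ne _ hz0, slope_def_module, sub_zero, norm_smul, norm_inv]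
        have h3 : ‖h z - h 0‖ ≤ (C + ‖h 0‖) * (1 + ‖z‖) ^ (N + 1) := by
          have h2 : (1:ℝ) ≤ (1 + ‖z‖) ^ (N+1) := one_le_pow₀ (by linarith [norm_nonneg z])
          calc ‖h z - h 0‖ ≤ ‖h z‖ + ‖h 0‖ := norm_sub_le _ _
            _ ≤ C * (1 + ‖z‖) ^ (N + 1) + ‖h 0‖ * (1 + ‖z‖) ^ (N + 1) :=
                add_le_add (hb z) (le_mul_of_one_le_right (norm_nonneg _) h2)
            _ = _ := by ring
        rw [inv_mul_le_iff₀ (by linarith)]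
        have h4 : 1 + ‖z‖ ≤ 2 * ‖z‖ := by linarith
        calc _ ≤ _ := h3
          _ = (C + ‖h 0‖) * (1 + ‖z‖) ^ N * (1 + ‖z‖) := by ring
          _ ≤ (C + ‖h 0‖) * (1 + ‖z‖) ^ N * (2 * ‖z‖) := by gcongr
          _ ≤ (C + ‖h 0‖) * (1 + ‖z‖) ^ N * (2 * ‖z‖) + ‖z‖ * (|K| * (1 + ‖z‖) ^ N) := by
              have : 0 ≤ ‖z‖ * (|K| * (1 + ‖z‖) ^ N) := by positivity
              linarith
          _ = _ := by ring
    obtain ⟨P, hP⟩ := ih hdd hbd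
    refine ⟨Polynomial.X * P + Polynomial.C (h 0), fun z => ?_⟩
    have := sub_smul_dslope h 0 z
    simp only [sub_zero, smul_eq_mul] at this
    simp only [Polynomial.eval_add, Polynomial.eval_mul, Polynomial.eval_X, Polynomial.eval_C,
      ← hP, this]
    ring

/-! ### Pointwise growth of functions in the Fock space. -/

/-- The sub-mean value property of `‖f‖` on discs. -/
theorem norm_mul_le_lintegral_ball {f : ℂ → ℂ} (hf : Differentiable ℂ f) (z : ℂ) {ρ : ℝ}
    (hρ : 0 < ρ) :
    ENNReal.ofReal (Real.pi * ρ ^ 2) * ‖f z‖ₑ ≤ ∫⁻ w in Metric.ball z ρ, ‖f w‖ₑ := by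
  -- The mean value property on each circle, to be integrated against `t dt` in polar coordinates.
  have hcirc : ∀ t : ℝ, ENNReal.ofReal (2 * Real.pi) * ‖f z‖ₑ ≤
      ∫⁻ θ in Set.Ioo (-Real.pi) Real.pi,
        ‖f (z + Complex.polarCoord.symm (t, θ))‖ₑ := by
    intro t
    have h1 : Real.circleAverage f z t = f z := (hf.diffContOnCl).circleAverage
    rw [Real.circleAverage_def] at h1
    have hper : Function.Periodic (fun θ => f (circleMap z t θ)) (2 * Real.pi) :=
      fun θ => by simp only [periodic_circleMap z t θ]
    have h2 : ∫ θ in (0:ℝ)..2 * Real.pi, f (circleMap z t θ) =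
        ∫ θ in Set.Ioc (-Real.pi) Real.pi, f (circleMap z t θ) := by
      rw [← intervalIntegral.integral_of_le (by linarith [Real.pi_pos])]
      have := hper.intervalIntegral_add_eq 0 (-Real.pi)
      rw [zero_add] at this
      rw [this]; congr 1; ring
    have h3 : ((2 * Real.pi : ℝ) : ℂ) * f z =
        ∫ θ in Set.Ioc (-Real.pi) Real.pi, f (circleMap z t θ) := by
      rw [← h2, ← h1, Complex.real_smul, ← mul_assoc, ← Complex.ofReal_mul,
        mul_inv_cancel₀ (by positivity), Complex.ofReal_one, one_mul]
    have h4 : ENNReal.ofReal (2 * Real.pi) * ‖f z‖ₑ = ‖((2 * Real.pi : ℝ) : ℂ) * f z‖ₑ := by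
      rw [enorm_mul]; congr 1
      rw [← ofReal_norm, Complex.norm_real, Real.norm_of_nonneg (by positivity)]
    rw [h4, h3]
    refine (enorm_integral_le_lintegral_enorm _).trans ?_
    rw [← Measure.restrict_congr_set (Ioo_ae_eq_Ioc (a := -Real.pi) (b := Real.pi))]
    apply le_of_eq
    congr 1
    ext θ
    rw [circleMap, Complex.polarCoord_symm_apply, Complex.exp_mul_I]
    simp
  have hshift : ∫⁻ w in Metric.ball z ρ, ‖f w‖ₑ =
      ∫⁻ w, (Metric.ball (0:ℂ) ρ).indicator (fun w => ‖f (z + w)‖ₑ) w := by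
    rw [← lintegral_indicator Metric.isOpen_ball.measurableSet,
      ← lintegral_add_left_eq_self _ z]
    congr 1
    ext w
    simp only [Set.indicator, Metric.mem_ball, dist_self_add_left, dist_zero_right]
  rw [hshift, ← Complex.lintegral_comp_polarCoord_symm, polarCoord_target,
    Measure.volume_eq_prod, setLIntegral_prod]
  · calc ENNReal.ofReal (Real.pi * ρ ^ 2) * ‖f z‖ₑ
        = ∫⁻ t in Set.Ioo 0 ρ, ENNReal.ofReal t * (ENNReal.ofReal (2 * Real.pi) * ‖f z‖ₑ) := by
          rw [lintegral_mul_const _ (by fun_prop)]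
          have : ∫⁻ t in Set.Ioo 0 ρ, ENNReal.ofReal t = ENNReal.ofReal (ρ ^ 2 / 2) := by
            rw [← ofReal_integral_eq_lintegral_ofReal]
            · rw [← integral_Ioc_eq_integral_Ioo, ← intervalIntegral.integral_of_le hρ.le,
                integral_id]
              simp
            · exact (continuous_id.integrableOn_Icc).mono_set Set.Ioo_subset_Icc_self
            · filter_upwards [ae_restrict_mem measurableSet_Ioo] with t ht using ht.1.le
          rw [this, ← mul_assoc, ← ENNReal.ofReal_mul (by positivity)]
          congr 2; ring
      _ ≤ ∫⁻ t in Set.Ioo 0 ρ, ∫⁻ θ in Set.Ioo (-Real.pi) Real.pi,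
            ENNReal.ofReal t • (Metric.ball (0:ℂ) ρ).indicator (fun w => ‖f (z + w)‖ₑ)
              (Complex.polarCoord.symm (t, θ)) := by
          apply setLIntegral_mono' measurableSet_Ioo
          intro t ht
          have : ∀ θ : ℝ, ENNReal.ofReal t • (Metric.ball (0:ℂ) ρ).indicator
              (fun w => ‖f (z + w)‖ₑ) (Complex.polarCoord.symm (t, θ)) =
              ENNReal.ofReal t * ‖f (z + Complex.polarCoord.symm (t, θ))‖ₑ := by
            intro θ
            rw [Set.indicator_of_mem, smul_eq_mul]
            rw [Metric.mem_ball, dist_zero_right, Complex.norm_polarCoord_symm]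
            simpa [abs_of_pos ht.1] using ht.2
          simp_rw [this]
          rw [lintegral_const_mul' _ _ ENNReal.ofReal_ne_top]
          gcongr
          exact hcirc t
      _ ≤ _ := lintegral_mono_set Set.Ioo_subset_Ioi_self
  · apply Measurable.aemeasurable
    simp only [smul_eq_mul]
    apply Measurable.mul (by fun_prop)
    apply Measurable.comp (g := (Metric.ball (0:ℂ) ρ).indicator (fun w => ‖f (z + w)‖ₑ))
    · refine Measurable.indicator ?_ Metric.isOpen_ball.measurableSet
      exact (hf.continuous.comp (continuous_const.add continuous_id)).enorm.measurable
    · have : (fun q : ℝ × ℝ => Complex.polarCoord.symm q) =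
          fun q => (q.1 : ℂ) * (Real.cos q.2 + Real.sin q.2 * Complex.I) :=
        funext fun q => Complex.polarCoord_symm_apply q
      change Measurable (fun q : ℝ × ℝ => Complex.polarCoord.symm q)
      rw [this]
      fun_prop

/-- The density is `p / 2` times the `p`-th power of `exp (-π ‖z‖² / 2)`, so the weight can be
carried along with `f` and no longer depends on `p`. -/
theorem memFock_iff {p : ℝ} (hp : 0 < p) {f : ℂ → ℂ} : MemFock p f ↔ Differentiable ℂ f ∧
    ∫⁻ z, ENNReal.ofReal (‖f z‖ * Real.exp (-(Real.pi / 2) * ‖z‖ ^ 2)) ^ p < ⊤ := by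
  refine and_congr_right fun hf => ?_
  have h : ∫⁻ z, ‖f z‖ₑ ^ p ∂(gaussianMeasureC (p * Real.pi)) =
      ENNReal.ofReal (p / 2) *
        ∫⁻ z, ENNReal.ofReal (‖f z‖ * Real.exp (-(Real.pi / 2) * ‖z‖ ^ 2)) ^ p := by
    rw [gaussianMeasureC, lintegral_withDensity_eq_lintegral_mul _ (by fun_prop)
      (hf.continuous.enorm.measurable.pow_const p), ← lintegral_const_mul' _ _ ENNReal.ofReal_ne_top]
    congr 1
    ext z
    rw [Pi.mul_apply, ENNReal.ofReal_mul (norm_nonneg _), ENNReal.mul_rpow_of_nonneg _ _ hp.le,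
      ofReal_norm, ENNReal.ofReal_rpow_of_nonneg (Real.exp_pos _).le hp.le, ← Real.exp_mul,
      ENNReal.ofReal_mul (by positivity)]
    have h1 : p * Real.pi / (2 * Real.pi) = p / 2 := by
      field_simp
    have h2 : -(Real.pi / 2) * ‖z‖ ^ 2 * p = -(p * Real.pi / 2) * ‖z‖ ^ 2 := by ring
    rw [h1, h2]
    ring
  rw [h]
  constructor
  · intro h'
    refine ENNReal.lt_top_of_mul_ne_top_right h'.ne ?_
    simp only [ne_eq, ENNReal.ofReal_eq_zero, not_le]; positivity
  · intro h'
    exact ENNReal.mul_lt_top ENNReal.ofReal_lt_top h'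

/-- Plays the part of Hölder's inequality when passing from the mean of `‖f‖` to that of `‖f‖ ^ p`;
the added constant is harmless on balls of radius at most 1. -/
theorem le_one_add_rpow {p : ℝ} (hp : 1 ≤ p) (x : ENNReal) : x ≤ 1 + x ^ p := by
  rcases le_total x 1 with h | h
  · exact h.trans le_self_add
  · calc x = x ^ (1:ℝ) := (ENNReal.rpow_one x).symm
      _ ≤ x ^ p := ENNReal.rpow_le_rpow_of_exponent_le h hp
      _ ≤ _ := le_add_self

/-- Pointwise growth of functions in the Fock space, up to a polynomial factor. -/
theorem MemFock.exists_norm_le {p : ℝ} (hp : 1 < p) {f : ℂ → ℂ} (hf : MemFock p f) :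
    ∃ C : ℝ, 0 ≤ C ∧ ∀ z, ‖f z‖ ≤ C * (1 + ‖z‖) ^ 2 * Real.exp (Real.pi / 2 * ‖z‖ ^ 2) := by
  rw [memFock_iff (by linarith)] at hf
  obtain ⟨hd, hI⟩ := hf
  set W : ℂ → ENNReal := fun z => ENNReal.ofReal (‖f z‖ * Real.exp (-(Real.pi / 2) * ‖z‖ ^ 2))
    with hW
  set I := ∫⁻ z, W z ^ p with hIdef
  refine ⟨Real.exp (3 * (Real.pi / 2)) * (Real.pi + I.toReal) / Real.pi, by positivity, fun z => ?_⟩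
  -- On a ball of this radius `‖w‖²` exceeds `‖z‖²` by at most 3, so the weight varies by a bounded
  -- factor; dividing by the area `π ρ²` costs `(1 + ‖z‖)²`.
  set ρ : ℝ := 1 / (1 + ‖z‖) with hρ
  have hz1 : 0 < 1 + ‖z‖ := by positivity
  have hρ0 : 0 < ρ := by positivity
  have hρ1 : ρ ≤ 1 := by rw [hρ, div_le_one hz1]; linarith [norm_nonneg z]
  have hρz : ρ * (1 + ‖z‖) = 1 := by rw [hρ]; field_simp
  have h1 := norm_mul_le_lintegral_ball hd z hρ0
  set E : ℝ := Real.exp (Real.pi / 2 * (‖z‖ ^ 2 + 3)) with hE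
  have h2 : ∫⁻ w in Metric.ball z ρ, ‖f w‖ₑ ≤
      ∫⁻ w in Metric.ball z ρ, ENNReal.ofReal E * (1 + W w ^ p) := by
    apply setLIntegral_mono' Metric.isOpen_ball.measurableSet
    intro w hw
    refine le_trans ?_ (mul_le_mul_right (le_one_add_rpow hp.le (W w)) _)
    rw [hW, ← ENNReal.ofReal_mul (Real.exp_pos _).le, ← ofReal_norm]
    apply ENNReal.ofReal_le_ofReal
    rw [mul_comm ‖f w‖, ← mul_assoc, ← Real.exp_add]
    apply le_mul_of_one_le_left (norm_nonneg _)
    rw [Real.one_le_exp_iff]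
    have h3 : ‖w‖ ≤ ‖z‖ + ρ := by
      have : ‖w - z‖ < ρ := by simpa [dist_eq_norm] using hw
      have := norm_le_norm_add_norm_sub' w z
      linarith
    have h4 : ‖w‖ ^ 2 ≤ ‖z‖ ^ 2 + 3 := by
      have : ‖w‖ ^ 2 ≤ (‖z‖ + ρ) ^ 2 := pow_le_pow_left₀ (norm_nonneg _) h3 2
      nlinarith
    nlinarith [Real.pi_pos]
  have h3 : ∫⁻ w in Metric.ball z ρ, ENNReal.ofReal E * (1 + W w ^ p) ≤
      ENNReal.ofReal (E * (Real.pi + I.toReal)) := by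
    rw [lintegral_const_mul' _ _ ENNReal.ofReal_ne_top, ENNReal.ofReal_mul (Real.exp_pos _).le,
      lintegral_add_left measurable_const, ENNReal.ofReal_add Real.pi_pos.le ENNReal.toReal_nonneg,
      ENNReal.ofReal_toReal hI.ne]
    gcongr
    · rw [setLIntegral_one, Complex.volume_ball, ← NNReal.coe_real_pi]
      have : ENNReal.ofReal ρ ≤ 1 := by simpa using hρ1
      rw [ENNReal.ofReal_coe_nnreal]
      calc _ ≤ 1 ^ 2 * (NNReal.pi : ENNReal) := by gcongr
        _ = _ := by simp
    · exact setLIntegral_le_lintegral _ _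
  have h4 := h1.trans (h2.trans h3)
  rw [← ofReal_norm, ← ENNReal.ofReal_mul (by positivity),
    ENNReal.ofReal_le_ofReal_iff (by positivity)] at h4
  have h5 : E = Real.exp (3 * (Real.pi / 2)) * Real.exp (Real.pi / 2 * ‖z‖ ^ 2) := by
    rw [hE, ← Real.exp_add]; congr 1; ring
  rw [h5] at h4
  have h6 : Real.pi * ‖f z‖ = (1 + ‖z‖) ^ 2 * (Real.pi * ρ ^ 2 * ‖f z‖) := by
    calc _ = (ρ * (1 + ‖z‖)) ^ 2 * (Real.pi * ‖f z‖) := by rw [hρz]; ring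
      _ = _ := by ring
  have h7 : Real.pi * ‖f z‖ ≤ (1 + ‖z‖) ^ 2 * (Real.exp (3 * (Real.pi / 2)) *
      Real.exp (Real.pi / 2 * ‖z‖ ^ 2) * (Real.pi + I.toReal)) := by
    rw [h6]; gcongr
  rw [div_mul_eq_mul_div, div_mul_eq_mul_div, le_div_iff₀ Real.pi_pos]
  calc _ = Real.pi * ‖f z‖ := by ring
    _ ≤ _ := h7
    _ = _ := by ring

/-! ### Division by an entire function with simple zeros. -/

/-- Division of entire functions: `f / S` is entire if `f` vanishes at the zeros of `S`, all of
which are simple. -/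
theorem exists_entire_mul_eq {f S : ℂ → ℂ} (hf : Differentiable ℂ f) (hS : Differentiable ℂ S)
    (hord : ∀ z, analyticOrderAt S z ≤ 1) (hz : ∀ z, S z = 0 → f z = 0) :
    ∃ h : ℂ → ℂ, Differentiable ℂ h ∧ ∀ z, f z = S z * h z := by
  have haf : ∀ z, AnalyticAt ℂ f z := fun z => hf.analyticAt z
  have haS : ∀ z, AnalyticAt ℂ S z := fun z => hS.analyticAt z
  have hloc : ∀ z, ∃ g : ℂ → ℂ, AnalyticAt ℂ g z ∧ ∀ᶠ w in nhds z, f w = S w * g w := by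
    intro z
    by_cases h0 : S z = 0
    · have h1 : analyticOrderAt S z = 1 := by
        refine le_antisymm (hord z) ?_
        rw [Order.one_le_iff_ne_zero]
        exact fun h => (haS z).analyticOrderAt_eq_zero.1 h h0
      obtain ⟨T, hT, hTz, hTe⟩ := ((haS z).analyticOrderAt_eq_natCast (n := 1)).1 h1
      have hda : AnalyticAt ℂ (dslope f z) z := by
        have hdd : Differentiable ℂ (dslope f z) := by
          rw [← differentiableOn_univ]
          exact (Complex.differentiableOn_dslope univ_mem).2 hf.differentiableOn
        exact hdd.analyticAt z
      -- Near a zero `z` both `f` and `S = (w - z) T` carry the factor `w - z`, which cancels.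
      refine ⟨fun w => dslope f z w / T w, hda.div hT hTz, ?_⟩
      filter_upwards [hTe, hT.continuousAt.eventually_ne hTz] with w hw hw0
      have := sub_smul_dslope f z w
      rw [hz z h0, sub_zero] at this
      rw [hw, ← this]
      simp only [smul_eq_mul, pow_one]
      field_simp
    · refine ⟨fun w => f w / S w, (haf z).div (haS z) h0, ?_⟩
      filter_upwards [(haS z).continuousAt.eventually_ne h0] with w hw
      field_simp
  choose g hg hgm using hloc
  -- The zeros of `S` are isolated, so local quotients agree on punctured neighbourhoods; the
  -- diagonal values `g w w` therefore coincide with `g z w` for `w` near `z`.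
  have hne : ∀ z, ∀ᶠ w in nhdsWithin z {z}ᶜ, S w ≠ 0 := by
    intro z
    rcases (haS z).eventually_eq_zero_or_eventually_ne_zero with h | h
    · have := hord z
      rw [analyticOrderAt_eq_top.2 h] at this
      simp at this
    · exact h
  have heq : ∀ z, ∀ᶠ w in nhds z, g w w = g z w := by
    intro z
    have hev : ∀ᶠ w in nhdsWithin z {z}ᶜ, g w w = g z w := by
      filter_upwards [hne z, (hgm z).filter_mono nhdsWithin_le_nhds] with w hw hw'
      have := (hgm w).self_of_nhds
      rw [this] at hw'
      exact mul_left_cancel₀ hw hw'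
    rw [eventually_nhdsWithin_iff] at hev
    filter_upwards [hev] with w hw
    by_cases h : w = z
    · rw [h]
    · exact hw h
  refine ⟨fun z => g z z, fun z => ?_, fun z => (hgm z).self_of_nhds⟩
  exact ((hg z).congr ((heq z).mono fun w hw => hw.symm)).differentiableAt

/-! ### Infinite products of entire functions with summable deviation from 1. -/

section InfiniteProducts

variable {P : ℕ → ℂ → ℂ} {u : ℕ → ℝ} {B : ℝ → ℝ}

theorem summable_norm_sub_one (hu : Summable u) (hP : ∀ n z, ‖P n z - 1‖ ≤ u n * B ‖z‖) (z : ℂ) :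
    Summable fun n => ‖P n z - 1‖ :=
  Summable.of_nonneg_of_le (fun _ => norm_nonneg _) (fun n => hP n z) (hu.mul_right _)

theorem multipliable_of_norm_sub_one_le (hu : Summable u)
    (hP : ∀ n z, ‖P n z - 1‖ ≤ u n * B ‖z‖) (z : ℂ) : Multipliable fun n => P n z := by
  have := multipliable_one_add_of_summable (summable_norm_sub_one hu hP z)
  simpa using this

theorem differentiable_tprod (hu : Summable u) (hu0 : ∀ n, 0 ≤ u n) (hB : Monotone B)
    (hP : ∀ n z, ‖P n z - 1‖ ≤ u n * B ‖z‖) (hd : ∀ n, Differentiable ℂ (P n)) :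
    Differentiable ℂ fun z => ∏' n, P n z := by
  intro z
  have h := Summable.hasProdLocallyUniformlyOn_nat_one_add (f := fun n z => P n z - 1)
    (K := Metric.ball 0 (‖z‖ + 1)) (u := fun n => u n * B (‖z‖ + 1)) Metric.isOpen_ball
    (hu.mul_right _) (Eventually.of_forall fun n x hx => (hP n x).trans
      (mul_le_mul_of_nonneg_left (hB (by simpa using (Metric.mem_ball.1 hx).le)) (hu0 n)))
    (fun n => ((hd n).sub_const 1).continuous.continuousOn)
  simp only [add_sub_cancel] at h
  rw [hasProdLocallyUniformlyOn_iff_tendstoLocallyUniformlyOn] at h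
  have h2 := h.differentiableOn (Eventually.of_forall fun s => by
    apply Differentiable.differentiableOn
    fun_prop) Metric.isOpen_ball
  exact h2.differentiableAt (Metric.isOpen_ball.mem_nhds (by simp))

theorem norm_tprod_sub_one_le (hu : Summable u) (hP : ∀ n z, ‖P n z - 1‖ ≤ u n * B ‖z‖) (z : ℂ) :
    ‖∏' n, P n z - 1‖ ≤ Real.exp ((∑' n, u n) * B ‖z‖) - 1 := by
  have h1 := (multipliable_of_norm_sub_one_le hu hP z).hasProd.tendsto_prod_nat
  refine le_of_tendsto ((h1.sub_const 1).norm) (Eventually.of_forall fun N => ?_)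
  have h2 := Finset.norm_prod_one_add_sub_one_le (Finset.range N) fun n => P n z - 1
  simp only [add_sub_cancel] at h2
  refine h2.trans ?_
  gcongr
  rw [← tsum_mul_right]
  refine (Finset.sum_le_sum fun n _ => hP n z).trans ?_
  exact (hu.mul_right _).sum_le_tsum _ fun n _ => (norm_nonneg _).trans (hP n z)

theorem norm_tprod_le (hu : Summable u) (hP : ∀ n z, ‖P n z - 1‖ ≤ u n * B ‖z‖) (z : ℂ) :
    ‖∏' n, P n z‖ ≤ Real.exp ((∑' n, u n) * B ‖z‖) := by
  have h1 := norm_tprod_sub_one_le hu hP z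
  have h2 := norm_le_norm_add_norm_sub' (∏' n, P n z) 1
  rw [norm_one] at h2
  linarith

theorem tprod_ne_zero (hu : Summable u) (hP : ∀ n z, ‖P n z - 1‖ ≤ u n * B ‖z‖) {z : ℂ}
    (hz : ∀ n, P n z ≠ 0) : ∏' n, P n z ≠ 0 := by
  have := tprod_one_add_ne_zero_of_summable (f := fun n => P n z - 1) (by simpa using hz)
    (summable_norm_sub_one hu hP z)
  simpa using this

theorem prod_range_mul_tprod (hu : Summable u) (hP : ∀ n z, ‖P n z - 1‖ ≤ u n * B ‖z‖) (z : ℂ)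
    (N : ℕ) : (∏ n ∈ Finset.range N, P n z) * ∏' n, P (n + N) z = ∏' n, P n z := by
  apply Multipliable.prod_mul_tprod_nat_mul'
  exact multipliable_of_norm_sub_one_le (P := fun n => P (n + N)) (u := fun n => u (n + N))
    ((summable_nat_add_iff N).2 hu) (fun n z => hP _ z) z

/-- Tails serve as auxiliary multipliers in the growth estimate for quotients; letting `N` tend to
infinity removes them. -/
theorem tendsto_tprod_tail (hu : Summable u) (hP : ∀ n z, ‖P n z - 1‖ ≤ u n * B ‖z‖) (z : ℂ) :
    Tendsto (fun N => ∏' n, P (n + N) z) atTop (nhds 1) := by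
  rw [tendsto_iff_norm_sub_tendsto_zero]
  have h1 : ∀ N, ‖∏' n, P (n + N) z - 1‖ ≤ Real.exp ((∑' n, u (n + N)) * B ‖z‖) - 1 := fun N =>
    norm_tprod_sub_one_le (P := fun n => P (n + N)) (u := fun n => u (n + N))
    ((summable_nat_add_iff N).2 hu) (fun n z => hP _ z) z
  refine squeeze_zero (fun _ => norm_nonneg _) h1 ?_
  have h2 := (((tendsto_sum_nat_add u).mul_const (B ‖z‖)).rexp).sub_const 1
  simpa using h2

end InfiniteProducts

/-! ### The nodes, grouped by four, and convergence of their product. -/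

/-- The points `i^j √(2(n+1))` of the unperturbed sequence. -/
noncomputable def alsNode (n : ℕ) (j : Fin 4) : ℂ := Complex.I ^ (j : ℕ) * (Real.sqrt (2 * (n + 1)) : ℂ)

/-- The points `i^j √(2(n+1)) exp (ε n j)` of the perturbed sequence. -/
noncomputable def pertNode (ε : ℕ → Fin 4 → ℂ) (n : ℕ) (j : Fin 4) : ℂ := alsNode n j * Complex.exp (ε n j)

/-- The normalized polynomial with zeros at the four perturbed points of index `n`. -/
noncomputable def nodeFactor (ε : ℕ → Fin 4 → ℂ) (n : ℕ) (z : ℂ) : ℂ := ∏ j, (1 - z / pertNode ε n j)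

theorem norm_alsNode (n : ℕ) (j : Fin 4) : ‖alsNode n j‖ = Real.sqrt (2 * (n + 1)) := by
  rw [alsNode, norm_mul, norm_pow, Complex.norm_I, one_pow, one_mul, Complex.norm_real,
    Real.norm_of_nonneg (Real.sqrt_nonneg _)]

theorem sqrt_two_mul_pos (n : ℕ) : 0 < Real.sqrt (2 * ((n : ℝ) + 1)) := by positivity

theorem alsNode_ne_zero (n : ℕ) (j : Fin 4) : alsNode n j ≠ 0 := by
  rw [← norm_pos_iff, norm_alsNode]; exact sqrt_two_mul_pos n

theorem pertNode_ne_zero (ε : ℕ → Fin 4 → ℂ) (n : ℕ) (j : Fin 4) : pertNode ε n j ≠ 0 :=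
  mul_ne_zero (alsNode_ne_zero n j) (Complex.exp_ne_zero _)

theorem differentiable_nodeFactor (ε : ℕ → Fin 4 → ℂ) (n : ℕ) :
    Differentiable ℂ (nodeFactor ε n) := by
  unfold nodeFactor
  fun_prop

theorem nodeFactor_eq_zero_iff {ε : ℕ → Fin 4 → ℂ} {n : ℕ} {z : ℂ} :
    nodeFactor ε n z = 0 ↔ ∃ j, z = pertNode ε n j := by
  rw [nodeFactor, Finset.prod_eq_zero_iff]
  simp only [Finset.mem_univ, true_and, sub_eq_zero]
  refine exists_congr fun j => ?_
  rw [eq_comm, div_eq_one_iff_eq (pertNode_ne_zero ε n j)]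

theorem sqrt_two_mul_sq (n : ℕ) : Real.sqrt (2 * ((n : ℝ) + 1)) ^ 2 = 2 * (n + 1) :=
  Real.sq_sqrt (by positivity)

/-- The four nodes are the roots of `z ^ 4 = 4 (n + 1) ^ 2`, so the product is a factor of Euler's
product for the sine, taken at `z ^ 2 / 2`. -/
theorem prod_one_sub_div_alsNode (n : ℕ) (z : ℂ) :
    ∏ j, (1 - z / alsNode n j) = 1 - (z ^ 2 / 2) ^ 2 / ((n : ℂ) + 1) ^ 2 := by
  set s : ℂ := (Real.sqrt (2 * ((n : ℝ) + 1)) : ℂ) with hs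
  have hs0 : s ≠ 0 := by
    rw [hs]; exact_mod_cast (sqrt_two_mul_pos n).ne'
  have hs2 : s ^ 2 = 2 * ((n : ℂ) + 1) := by
    rw [hs, ← Complex.ofReal_pow, sqrt_two_mul_sq]; push_cast; ring
  have hn : (n : ℂ) + 1 = s ^ 2 / 2 := by rw [hs2]; ring
  rw [hn]
  simp only [alsNode, ← hs, Fin.prod_univ_four]
  have e0 : Complex.I ^ ((0 : Fin 4) : ℕ) = 1 := by simp
  have e1 : Complex.I ^ ((1 : Fin 4) : ℕ) = Complex.I := by simp
  have e2 : Complex.I ^ ((2 : Fin 4) : ℕ) = -1 := by simp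
  have e3 : Complex.I ^ ((3 : Fin 4) : ℕ) = -Complex.I := Complex.I_pow_three
  have hI := Complex.I_sq
  rw [e0, e1, e2, e3]
  have d1 : z / (Complex.I * s) = -(z / s) * Complex.I := by
    field_simp; linear_combination z * hI
  have d2 : z / (-1 * s) = -(z / s) := by rw [neg_one_mul, div_neg]
  have d3 : z / (-Complex.I * s) = (z / s) * Complex.I := by
    rw [neg_mul, div_neg, d1]; ring
  have d0 : z / (1 * s) = z / s := by rw [one_mul]
  have d4 : (z ^ 2 / 2) ^ 2 / (s ^ 2 / 2) ^ 2 = (z / s) ^ 4 := by field_simp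
  rw [d0, d1, d2, d3, d4]
  linear_combination (-(z / s) ^ 2 + (z / s) ^ 4) * hI

theorem norm_exp_sub_one_le_mul_exp (x : ℂ) : ‖Complex.exp x - 1‖ ≤ ‖x‖ * Real.exp ‖x‖ := by
  have := Complex.norm_exp_sub_sum_le_norm_mul_exp x 1
  simpa using this

/-- Telescoping: one factor is exchanged at a time. -/
theorem norm_prod_four_sub_prod_le {a b : Fin 4 → ℂ} {U V : ℝ} (ha : ∀ j, ‖a j‖ ≤ U)
    (hb : ∀ j, ‖b j‖ ≤ U) (hab : ∀ j, ‖b j - a j‖ ≤ V) :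
    ‖∏ j, b j - ∏ j, a j‖ ≤ 4 * V * U ^ 3 := by
  have hU : 0 ≤ U := (norm_nonneg _).trans (ha 0)
  have hV : 0 ≤ V := (norm_nonneg _).trans (hab 0)
  rw [Fin.prod_univ_four, Fin.prod_univ_four]
  have : b 0 * b 1 * b 2 * b 3 - a 0 * a 1 * a 2 * a 3 =
      (b 0 - a 0) * (b 1 * b 2 * b 3) + (b 1 - a 1) * (a 0 * b 2 * b 3) +
      (b 2 - a 2) * (a 0 * a 1 * b 3) + (b 3 - a 3) * (a 0 * a 1 * a 2) := by ring
  rw [this]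
  have h3 : ∀ x y w v : ℂ, ‖x‖ ≤ V → ‖y‖ ≤ U → ‖w‖ ≤ U → ‖v‖ ≤ U → ‖x * (y * w * v)‖ ≤ V * U ^ 3 := by
    intro x y w v hx hy hw hv
    rw [norm_mul, norm_mul, norm_mul, show U ^ 3 = U * U * U by ring]
    gcongr
  calc _ ≤ V * U ^ 3 + V * U ^ 3 + V * U ^ 3 + V * U ^ 3 := by
        refine (norm_add_le _ _).trans (add_le_add ((norm_add_le _ _).trans (add_le_add
          ((norm_add_le _ _).trans (add_le_add ?_ ?_)) ?_)) ?_)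
        · exact h3 _ _ _ _ (hab 0) (hb 1) (hb 2) (hb 3)
        · exact h3 _ _ _ _ (hab 1) (ha 0) (hb 2) (hb 3)
        · exact h3 _ _ _ _ (hab 2) (ha 0) (ha 1) (hb 3)
        · exact h3 _ _ _ _ (hab 3) (ha 0) (ha 1) (ha 2)
    _ = _ := by ring

theorem exists_norm_exp_sub_one_le {ε : ℕ → Fin 4 → ℂ} {C : ℝ}
    (hε : ∀ n j, ‖ε n j‖ ≤ C / (n + 1)) :
    ∃ K : ℝ, 1 ≤ K ∧ ∀ n j, ‖Complex.exp (ε n j) - 1‖ ≤ K / (n + 1) ∧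
      ‖Complex.exp (-ε n j) - 1‖ ≤ K / (n + 1) := by
  have hC : 0 ≤ C := by
    have := (norm_nonneg _).trans (hε 0 0)
    simpa using this
  refine ⟨1 + C * Real.exp C, by have := Real.exp_pos C; nlinarith, fun n j => ?_⟩
  have hn : (0:ℝ) < n + 1 := by positivity
  have key : ∀ x : ℂ, ‖x‖ = ‖ε n j‖ → ‖Complex.exp x - 1‖ ≤ (1 + C * Real.exp C) / (n + 1) := by
    intro x hx
    have h1 := norm_exp_sub_one_le_mul_exp x
    rw [hx] at h1
    have h2 : ‖ε n j‖ ≤ C := (hε n j).trans (div_le_self hC (by linarith [n.cast_nonneg (α := ℝ)]))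
    calc _ ≤ _ := h1
      _ ≤ C / (n + 1) * Real.exp C := by gcongr; exact hε n j
      _ = (C * Real.exp C) / (n + 1) := by ring
      _ ≤ _ := by gcongr; linarith
  exact ⟨key _ rfl, key _ (norm_neg _)⟩

theorem summable_inv_mul_sqrt (K : ℝ) :
    Summable fun n : ℕ => K / (((n : ℝ) + 1) * Real.sqrt (n + 1)) := by
  have h := (Real.summable_one_div_nat_rpow (p := 3 / 2)).2 (by norm_num)
  have h2 := ((summable_nat_add_iff 1).2 h).mul_left K
  refine h2.congr fun n => ?_
  have : ((n + 1 : ℕ) : ℝ) ^ (3 / 2 : ℝ) = ((n : ℝ) + 1) * Real.sqrt (n + 1) := by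
    rw [show (3 / 2 : ℝ) = 1 + 1 / 2 by norm_num, Real.rpow_add (by positivity), Real.rpow_one,
      Real.sqrt_eq_rpow]
    push_cast; rfl
  rw [this]; ring

theorem one_le_sqrt_succ (n : ℕ) : 1 ≤ Real.sqrt ((n : ℝ) + 1) := by
  rw [Real.one_le_sqrt]; linarith [n.cast_nonneg (α := ℝ)]

theorem sqrt_succ_le_sqrt_two_mul (n : ℕ) :
    Real.sqrt ((n : ℝ) + 1) ≤ Real.sqrt (2 * ((n : ℝ) + 1)) :=
  Real.sqrt_le_sqrt (by linarith [n.cast_nonneg (α := ℝ)])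

/-- The four unperturbed factors multiply to `1 + O(‖z‖⁴ / n²)`, and a relative displacement `O(1 /
n)` of a node changes its linear factor by `O(‖z‖ / n ^ (3/2))`. Grouping by four is essential: a
single linear factor differs from 1 by order `n ^ (-1/2)`. -/
theorem exists_norm_nodeFactor_sub_one_le {ε : ℕ → Fin 4 → ℂ} {C : ℝ}
    (hε : ∀ n j, ‖ε n j‖ ≤ C / (n + 1)) :
    ∃ K : ℝ, 0 ≤ K ∧ ∀ n z, ‖nodeFactor ε n z - 1‖ ≤
      K / (((n : ℝ) + 1) * Real.sqrt (n + 1)) * (1 + max ‖z‖ 0) ^ 4 := by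
  obtain ⟨K, hK1, hK⟩ := exists_norm_exp_sub_one_le hε
  refine ⟨1 + 4 * K * (2 + K) ^ 3, by positivity, fun n z => ?_⟩
  rw [max_eq_left (norm_nonneg z)]
  set r := ‖z‖ with hr
  have hr0 : 0 ≤ r := norm_nonneg z
  set t := Real.sqrt ((n : ℝ) + 1) with ht
  have ht1 : 1 ≤ t := one_le_sqrt_succ n
  have htsq : (n : ℝ) + 1 = t ^ 2 := (Real.sq_sqrt (by positivity)).symm
  have hu : ∀ j, ‖z / alsNode n j‖ ≤ r / t := by
    intro j
    rw [norm_div, norm_alsNode]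
    exact div_le_div_of_nonneg_left hr0 (by linarith) (sqrt_succ_le_sqrt_two_mul n)
  have hrt : r / t ≤ r := div_le_self hr0 ht1
  have hdiv : ∀ j, z / pertNode ε n j = z / alsNode n j * Complex.exp (-ε n j) := by
    intro j
    rw [pertNode, Complex.exp_neg, div_mul_eq_div_div, div_eq_mul_inv (z / alsNode n j)]
  have hK' : ∀ j, ‖Complex.exp (-ε n j) - 1‖ ≤ K / t ^ 2 := fun j => by
    rw [← htsq]; exact (hK n j).2
  have hKle : K / t ^ 2 ≤ K := div_le_self (by linarith) (one_le_pow₀ ht1)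
  have hexp : ∀ j, ‖Complex.exp (-ε n j)‖ ≤ 1 + K := by
    intro j
    have := norm_le_norm_add_norm_sub' (Complex.exp (-ε n j)) 1
    rw [norm_one] at this
    linarith [hK' j]
  have h1 := norm_prod_four_sub_prod_le (a := fun j => 1 - z / alsNode n j)
    (b := fun j => 1 - z / pertNode ε n j) (U := (2 + K) * (1 + r)) (V := r / t * (K / t ^ 2))
    (fun j => by
      refine (norm_sub_le _ _).trans ?_
      rw [norm_one]
      have := hu j
      nlinarith)
    (fun j => by
      refine (norm_sub_le _ _).trans ?_
      rw [norm_one, hdiv, norm_mul]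
      have : ‖z / alsNode n j‖ * ‖Complex.exp (-ε n j)‖ ≤ r * (1 + K) := by
        have := (hu j).trans hrt
        gcongr
        exact hexp j
      nlinarith)
    (fun j => by
      rw [hdiv, show (1 - z / alsNode n j * Complex.exp (-ε n j)) - (1 - z / alsNode n j) =
        -(z / alsNode n j * (Complex.exp (-ε n j) - 1)) by ring, norm_neg, norm_mul]
      exact mul_le_mul (hu j) (hK' j) (norm_nonneg _) (by positivity))
  rw [prod_one_sub_div_alsNode] at h1
  have h2 : ‖(z ^ 2 / 2) ^ 2 / ((n : ℂ) + 1) ^ 2‖ ≤ r ^ 4 / t ^ 3 := by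
    have hn : ‖(n : ℂ) + 1‖ = t ^ 2 := by
      rw [← htsq]
      have : (n : ℂ) + 1 = ((n + 1 : ℝ) : ℂ) := by push_cast; rfl
      rw [this, Complex.norm_real, Real.norm_of_nonneg (by positivity)]
    rw [norm_div, norm_pow, norm_pow, norm_div, norm_pow, hn, ← hr]
    have : t ^ 3 ≤ (t ^ 2) ^ 2 := by
      rw [← pow_mul]; exact pow_le_pow_right₀ ht1 (by norm_num)
    rw [show ‖(2:ℂ)‖ = 2 by simp]
    have h4 : 0 ≤ r ^ 4 := by positivity
    have h5 : (r ^ 2 / 2) ^ 2 ≤ r ^ 4 := by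
      rw [show (r ^ 2 / 2) ^ 2 = r ^ 4 / 4 by ring]; linarith
    gcongr
  have h3 : nodeFactor ε n z - 1 = (∏ j, (1 - z / pertNode ε n j) -
      (1 - (z ^ 2 / 2) ^ 2 / ((n : ℂ) + 1) ^ 2)) + -((z ^ 2 / 2) ^ 2 / ((n : ℂ) + 1) ^ 2) := by
    rw [nodeFactor]; ring
  rw [h3]
  refine (norm_add_le _ _).trans ?_
  rw [norm_neg, htsq]
  have ht3 : 0 < t ^ 3 := by positivity
  calc _ ≤ 4 * (r / t * (K / t ^ 2)) * ((2 + K) * (1 + r)) ^ 3 + r ^ 4 / t ^ 3 := add_le_add h1 h2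
    _ = (4 * K * (2 + K) ^ 3 * (r * (1 + r) ^ 3) + r ^ 4) / t ^ 3 := by field_simp
    _ ≤ (4 * K * (2 + K) ^ 3 * (1 + r) ^ 4 + (1 + r) ^ 4) / t ^ 3 := by
        have h6 : r * (1 + r) ^ 3 ≤ (1 + r) ^ 4 := by
          rw [show (1 + r) ^ 4 = (1 + r) * (1 + r) ^ 3 by ring]; gcongr; linarith
        gcongr
        linarith
    _ = _ := by field_simp; ring

/-! ### Size of the product near the diagonals. -/

/-- The double sectors around the diagonals, where `|Im z²| ≥ |z|² / 2`. -/
def diagonalSector : Set ℂ := {z | ‖z‖ ^ 2 / 2 ≤ |(z ^ 2).im|}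

theorem quarter_norm_le_of_mem_diagonalSector {z : ℂ} (hz : z ∈ diagonalSector) :
    ‖z‖ / 4 ≤ |z.re| ∧ ‖z‖ / 4 ≤ |z.im| := by
  have h1 : ‖z‖ ^ 2 / 2 ≤ |(z ^ 2).im| := hz
  have h2 : (z ^ 2).im = 2 * (z.re * z.im) := by rw [pow_two, Complex.mul_im]; ring
  rw [h2, abs_mul, abs_mul, abs_two] at h1
  have hx := Complex.abs_re_le_norm z
  have hy := Complex.abs_im_le_norm z
  rcases (norm_nonneg z).eq_or_lt with h0 | h0
  · rw [← h0]; constructor <;> simp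
  · constructor <;> by_contra! h <;> nlinarith [abs_nonneg z.re, abs_nonneg z.im]

/-- The nodes lie on the coordinate axes, and points of the sector are at distance at least `‖z‖ /
4` from both axes. -/
theorem quarter_norm_le_norm_alsNode_sub {z : ℂ} (hz : z ∈ diagonalSector) (n : ℕ) (j : Fin 4) :
    ‖z‖ / 4 ≤ ‖alsNode n j - z‖ := by
  obtain ⟨h1, h2⟩ := quarter_norm_le_of_mem_diagonalSector hz
  have h3 := Complex.abs_re_le_norm (alsNode n j - z)
  have h4 := Complex.abs_im_le_norm (alsNode n j - z)
  rw [Complex.sub_re] at h3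
  rw [Complex.sub_im] at h4
  have h5 : (alsNode n j).re = 0 ∨ (alsNode n j).im = 0 := by
    unfold alsNode
    fin_cases j
    · right; simp
    · left; simp
    · right; simp
    · left
      have e3 : Complex.I ^ 3 = -Complex.I := Complex.I_pow_three
      simp [e3]
  rcases h5 with h5 | h5
  · rw [h5, zero_sub, abs_neg] at h3; linarith
  · rw [h5, zero_sub, abs_neg] at h4; linarith

/-- If the node has modulus at most `2 ‖z‖`, the preceding bound suffices; otherwise the triangle
inequality does. -/
theorem eighth_sqrt_le_norm_alsNode_sub {z : ℂ} (hz : z ∈ diagonalSector) (n : ℕ) (j : Fin 4) :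
    Real.sqrt (2 * (n + 1)) / 8 ≤ ‖alsNode n j - z‖ := by
  have h1 := quarter_norm_le_norm_alsNode_sub hz n j
  have h2 := norm_sub_norm_le (alsNode n j) z
  rw [norm_alsNode] at h2
  have := norm_nonneg z
  have := sqrt_two_mul_pos n
  by_cases h : Real.sqrt (2 * (n + 1)) ≤ 2 * ‖z‖
  · linarith
  · linarith

/-- Turns relative errors into exponents, so that the errors of many factors simply add up. -/
theorem exp_neg_le_norm_one_add_le_exp {w : ℂ} {e : ℝ} (hw : ‖w‖ ≤ e) (he : e ≤ 1 / 2) :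
    Real.exp (-(2 * e)) ≤ ‖1 + w‖ ∧ ‖1 + w‖ ≤ Real.exp (2 * e) := by
  have h0 := norm_nonneg w
  have h1 : ‖1 + w‖ ≤ 1 + ‖w‖ := (norm_add_le _ _).trans (by simp)
  have h2 : 1 - ‖w‖ ≤ ‖1 + w‖ := by
    have := norm_sub_norm_le (1 : ℂ) (-w)
    simpa using this
  constructor
  · have h3 : Real.exp (-(2 * e)) ≤ 1 / (1 + 2 * e) := by
      rw [Real.exp_neg, ← one_div]
      exact one_div_le_one_div_of_le (by linarith) (by linarith [Real.add_one_le_exp (2 * e)])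
    have h4 : 1 / (1 + 2 * e) ≤ 1 - e := by
      rw [div_le_iff₀ (by linarith)]; nlinarith
    linarith
  · linarith [Real.add_one_le_exp (2 * e)]

/-- The error committed on a linear factor of index `n` at distance `r` from the origin. -/
noncomputable def nodeError (K r : ℝ) (n : ℕ) : ℝ :=
  if n < ⌊r ^ 2⌋₊ then 6 * K / (Real.sqrt (n + 1) * r) else 8 * K * r / Real.sqrt (n + 1) ^ 3

theorem nodeError_le_half {K r : ℝ} (hK : 1 ≤ K) (hr : 16 * K ≤ r) (n : ℕ) :
    nodeError K r n ≤ 1 / 2 := by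
  have hr0 : 0 < r := by linarith
  have ht := one_le_sqrt_succ n
  rw [nodeError]
  split_ifs with h
  · rw [div_le_iff₀ (by positivity)]; nlinarith
  · have h1 : r ^ 2 < n + 1 := by
      push Not at h
      exact (Nat.lt_floor_add_one (r ^ 2)).trans_le (by exact_mod_cast Nat.add_le_add_right h 1)
    have h2 : r ≤ Real.sqrt (n + 1) := Real.le_sqrt_of_sq_le h1.le
    have h3 : r ^ 3 ≤ Real.sqrt (n + 1) ^ 3 := pow_le_pow_left₀ hr0.le h2 3
    rw [div_le_iff₀ (by positivity)]
    have h4 : r ≤ r ^ 2 := by nlinarith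
    nlinarith [mul_le_mul_of_nonneg_left (hr.trans h4) hr0.le]

/-- Comparison of `(n + 1) ^ (-1/2)` with an increment of `2 √x`, so that sums telescope; the next
lemma does the same for `(n + 1) ^ (-3/2)`. -/
theorem inv_sqrt_succ_le (n : ℕ) :
    1 / Real.sqrt ((n : ℝ) + 1) ≤ 2 * (Real.sqrt (n + 1) - Real.sqrt n) := by
  have h1 := one_le_sqrt_succ n
  have h2 : Real.sqrt ((n : ℝ) + 1) ^ 2 = n + 1 := Real.sq_sqrt (by positivity)
  have h3 : Real.sqrt (n : ℝ) ^ 2 = n := Real.sq_sqrt (by positivity)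
  rw [div_le_iff₀ (by linarith)]
  nlinarith [sq_nonneg (Real.sqrt ((n : ℝ) + 1) - Real.sqrt n)]

theorem inv_sqrt_succ_pow_three_le {n : ℕ} (hn : 1 ≤ n) :
    1 / Real.sqrt ((n : ℝ) + 1) ^ 3 ≤ 2 * (1 / Real.sqrt n - 1 / Real.sqrt (n + 1)) := by
  have h1 := one_le_sqrt_succ n
  have hn' : (1 : ℝ) ≤ n := by exact_mod_cast hn
  have h0 : 0 < Real.sqrt (n : ℝ) := Real.sqrt_pos.2 (by linarith)
  have h4 : Real.sqrt (n : ℝ) ≤ Real.sqrt (n + 1) := Real.sqrt_le_sqrt (by linarith)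
  have h5 := inv_sqrt_succ_le n
  have h6 : 1 / Real.sqrt n - 1 / Real.sqrt ((n : ℝ) + 1) =
      (Real.sqrt (n + 1) - Real.sqrt n) / (Real.sqrt n * Real.sqrt (n + 1)) := by
    field_simp
  rw [h6]
  calc 1 / Real.sqrt ((n : ℝ) + 1) ^ 3
      = 1 / Real.sqrt ((n : ℝ) + 1) / (Real.sqrt (n + 1) * Real.sqrt (n + 1)) := by
        field_simp
    _ ≤ 2 * (Real.sqrt (n + 1) - Real.sqrt n) / (Real.sqrt n * Real.sqrt (n + 1)) := by
        gcongr
    _ = _ := by ring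

/-- The cut at `⌊r ^ 2⌋` balances the two regimes: below it the sum of `1 / (√n r)` is of order `√(r
^ 2) / r`, above it `r` times the sum of `n ^ (-3/2)` is of order `r / r`. They contribute `12 K`
and `32 K`, independently of `r`. -/
theorem sum_nodeError_le {K r : ℝ} (hK : 1 ≤ K) (hr : 16 * K ≤ r) (N : ℕ) :
    ∑ n ∈ Finset.range N, nodeError K r n ≤ 44 * K := by
  have hr0 : 0 < r := by linarith
  set m := ⌊r ^ 2⌋₊ with hm
  have hmr : (m : ℝ) ≤ r ^ 2 := Nat.floor_le (by positivity)
  have hmr' : r ^ 2 < m + 1 := Nat.lt_floor_add_one _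
  have hm1 : 1 ≤ m := by
    rw [hm, Nat.one_le_floor_iff]; nlinarith
  have hsm : Real.sqrt m ≤ r := Real.sqrt_le_iff.2 ⟨hr0.le, hmr⟩
  have hsm' : r / 2 ≤ Real.sqrt m := Real.le_sqrt_of_sq_le (by nlinarith)
  have first : ∀ N ≤ m, ∑ n ∈ Finset.range N, nodeError K r n ≤ 12 * K / r * Real.sqrt N := by
    intro N
    induction N with
    | zero => simp
    | succ N ih =>
      intro hN
      rw [Finset.sum_range_succ]
      have h1 := ih (by omega)
      have h2 : nodeError K r N = 6 * K / r * (1 / Real.sqrt (N + 1)) := by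
        rw [nodeError, if_pos (by omega)]
        field_simp
      have h3 : 6 * K / r * (1 / Real.sqrt ((N : ℝ) + 1)) ≤
          6 * K / r * (2 * (Real.sqrt (N + 1) - Real.sqrt N)) := by
        gcongr; exact inv_sqrt_succ_le N
      rw [h2]
      push_cast
      have h4 : 6 * K / r * (2 * (Real.sqrt ((N : ℝ) + 1) - Real.sqrt N)) =
        12 * K / r * Real.sqrt (N + 1) - 12 * K / r * Real.sqrt N := by ring
      linarith
  have hfirst : ∀ N ≤ m, ∑ n ∈ Finset.range N, nodeError K r n ≤ 12 * K := by
    intro N hN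
    refine (first N hN).trans ?_
    have : Real.sqrt N ≤ r := (Real.sqrt_le_sqrt (by exact_mod_cast hN)).trans hsm
    calc 12 * K / r * Real.sqrt N ≤ 12 * K / r * r := by gcongr
      _ = 12 * K := by field_simp
  have second : ∀ N, m ≤ N → ∑ n ∈ Finset.range N, nodeError K r n ≤
      12 * K + 16 * K * r * (1 / Real.sqrt m - 1 / Real.sqrt N) := by
    intro N hN
    induction N, hN using Nat.le_induction with
    | base => simpa using hfirst m le_rfl
    | succ N hN ih =>
      rw [Finset.sum_range_succ]
      have h2 : nodeError K r N = 8 * K * r * (1 / Real.sqrt (N + 1) ^ 3) := by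
        rw [nodeError, if_neg (by omega)]
        ring
      have h3 : 8 * K * r * (1 / Real.sqrt ((N : ℝ) + 1) ^ 3) ≤
          8 * K * r * (2 * (1 / Real.sqrt N - 1 / Real.sqrt (N + 1))) := by
        gcongr; exact inv_sqrt_succ_pow_three_le (by omega)
      rw [h2]
      push_cast
      linarith
  by_cases hN : N ≤ m
  · linarith [hfirst N hN]
  · refine (second N (by omega)).trans ?_
    have h1 : 1 / Real.sqrt m ≤ 2 / r := by
      rw [div_le_div_iff₀ (by linarith) hr0]; linarith
    have h2 : 0 ≤ 1 / Real.sqrt N := by positivity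
    calc 12 * K + 16 * K * r * (1 / Real.sqrt m - 1 / Real.sqrt N)
        ≤ 12 * K + 16 * K * r * (2 / r) := by gcongr; linarith
      _ = 44 * K := by field_simp; ring

/-- For an index below `‖z‖ ^ 2` the factor is `(1 - z/γ) exp (-ε) (1 + w)` with `w = γ (exp ε - 1)
/ (γ - z)`; for a later one it is `(1 - z/γ) (1 + w)` with `w = -z (exp (-ε) - 1) / (γ - z)`. Since
`z` keeps away from the nodes, `nodeError` dominates `w`. Only the first kind leaves a factor `exp
(-Re ε)`, and the product of these is governed by the sums of the `Δ_k`. -/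
theorem norm_one_sub_div_pertNode_bounds {ε : ℕ → Fin 4 → ℂ} {K : ℝ} (hK1 : 1 ≤ K)
    (hK : ∀ n j, ‖Complex.exp (ε n j) - 1‖ ≤ K / (n + 1) ∧
      ‖Complex.exp (-ε n j) - 1‖ ≤ K / (n + 1)) {z : ℂ} (hz : z ∈ diagonalSector)
    (hr : 16 * K ≤ ‖z‖) (n : ℕ) (j : Fin 4) :
    Real.exp (-(2 * nodeError K ‖z‖ n)) *
        (‖1 - z / alsNode n j‖ * Real.exp (-if n < ⌊‖z‖ ^ 2⌋₊ then (ε n j).re else 0)) ≤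
      ‖1 - z / pertNode ε n j‖ ∧
    ‖1 - z / pertNode ε n j‖ ≤ Real.exp (2 * nodeError K ‖z‖ n) *
        (‖1 - z / alsNode n j‖ * Real.exp (-if n < ⌊‖z‖ ^ 2⌋₊ then (ε n j).re else 0)) := by
  set r := ‖z‖ with hrdef
  have hr0 : 0 < r := by linarith
  set γ := alsNode n j with hγ
  have hγ0 : γ ≠ 0 := alsNode_ne_zero n j
  have hd1 : r / 4 ≤ ‖γ - z‖ := quarter_norm_le_norm_alsNode_sub hz n j
  have hd2 := eighth_sqrt_le_norm_alsNode_sub hz n j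
  have hγz : γ - z ≠ 0 := by rw [← norm_pos_iff]; linarith
  set t := Real.sqrt ((n : ℝ) + 1) with ht
  have ht1 : 1 ≤ t := one_le_sqrt_succ n
  have htsq : (n : ℝ) + 1 = t ^ 2 := (Real.sq_sqrt (by positivity)).symm
  have hst : t ≤ Real.sqrt (2 * (n + 1)) := sqrt_succ_le_sqrt_two_mul n
  have hst' : Real.sqrt (2 * (n + 1)) ≤ 3 / 2 * t := by
    rw [Real.sqrt_le_iff, htsq]
    constructor
    · positivity
    · nlinarith
  have main : ∃ w : ℂ, ‖w‖ ≤ nodeError K r n ∧ ‖1 - z / pertNode ε n j‖ =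
      ‖1 - z / γ‖ * Real.exp (-if n < ⌊r ^ 2⌋₊ then (ε n j).re else 0) * ‖1 + w‖ := by
    have hE := Complex.exp_ne_zero (ε n j)
    rw [nodeError]
    split_ifs with h
    · refine ⟨γ * (Complex.exp (ε n j) - 1) / (γ - z), ?_, ?_⟩
      · rw [norm_div, norm_mul, hγ, norm_alsNode, ← hγ]
        have h1 := (hK n j).1
        rw [htsq] at h1
        calc _ ≤ (3 / 2 * t) * (K / t ^ 2) / (r / 4) := by gcongr
          _ = _ := by field_simp; ring
      · rw [← Complex.neg_re, ← Complex.norm_exp, ← norm_mul, ← norm_mul, Complex.exp_neg]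
        congr 1
        rw [pertNode, ← hγ]
        field_simp
        ring
    · refine ⟨-(z * (Complex.exp (-ε n j) - 1)) / (γ - z), ?_, ?_⟩
      · rw [norm_div, norm_neg, norm_mul]
        have h1 := (hK n j).2
        rw [htsq] at h1
        calc _ ≤ r * (K / t ^ 2) / (t / 8) := by gcongr; linarith
          _ = _ := by rw [← ht]; field_simp
      · rw [neg_zero, Real.exp_zero, mul_one, ← norm_mul, Complex.exp_neg]
        congr 1
        rw [pertNode, ← hγ]
        field_simp
        ring
  obtain ⟨w, hw, he⟩ := main
  obtain ⟨h1, h2⟩ := exp_neg_le_norm_one_add_le_exp hw (nodeError_le_half hK1 hr n)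
  rw [he]
  constructor
  · rw [mul_comm]; gcongr
  · rw [mul_comm (Real.exp _)]; gcongr

/-- Four factors per index, exponent `2 * nodeError` for each, and total error `44 K`: this gives `4
* 2 * 44 = 352`. -/
theorem norm_prod_nodeFactor_bounds {ε : ℕ → Fin 4 → ℂ} {K : ℝ} (hK1 : 1 ≤ K)
    (hK : ∀ n j, ‖Complex.exp (ε n j) - 1‖ ≤ K / (n + 1) ∧
      ‖Complex.exp (-ε n j) - 1‖ ≤ K / (n + 1)) {z : ℂ} (hz : z ∈ diagonalSector)
    (hr : 16 * K ≤ ‖z‖) {N : ℕ} (hN : ⌊‖z‖ ^ 2⌋₊ ≤ N) :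
    Real.exp (-(352 * K)) *
        (‖∏ n ∈ Finset.range N, (1 - (z ^ 2 / 2) ^ 2 / ((n : ℂ) + 1) ^ 2)‖ *
          Real.exp (-∑ n ∈ Finset.range ⌊‖z‖ ^ 2⌋₊, ∑ j, (ε n j).re)) ≤
      ‖∏ n ∈ Finset.range N, nodeFactor ε n z‖ ∧
    ‖∏ n ∈ Finset.range N, nodeFactor ε n z‖ ≤ Real.exp (352 * K) *
        (‖∏ n ∈ Finset.range N, (1 - (z ^ 2 / 2) ^ 2 / ((n : ℂ) + 1) ^ 2)‖ *
          Real.exp (-∑ n ∈ Finset.range ⌊‖z‖ ^ 2⌋₊, ∑ j, (ε n j).re)) := by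
  set m := ⌊‖z‖ ^ 2⌋₊ with hm
  have hb := norm_one_sub_div_pertNode_bounds hK1 hK hz hr
  rw [← hm] at hb
  have hsum : ∑ n ∈ Finset.range m, ∑ j, (ε n j).re =
      ∑ n ∈ Finset.range N, ∑ j, if n < m then (ε n j).re else 0 := by
    rw [← Finset.sum_subset (Finset.range_subset_range.2 hN)]
    · refine Finset.sum_congr rfl fun n hn => ?_
      simp [Finset.mem_range.1 hn]
    · intro n _ hn
      simp only [Finset.mem_range] at hn
      simp [hn]
  have hE : ‖∏ n ∈ Finset.range N, (1 - (z ^ 2 / 2) ^ 2 / ((n : ℂ) + 1) ^ 2)‖ *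
      Real.exp (-∑ n ∈ Finset.range m, ∑ j, (ε n j).re) =
      ∏ n ∈ Finset.range N, ∏ j, (‖1 - z / alsNode n j‖ *
        Real.exp (-if n < m then (ε n j).re else 0)) := by
    rw [hsum, ← Finset.sum_neg_distrib, Real.exp_sum, norm_prod, ← Finset.prod_mul_distrib]
    refine Finset.prod_congr rfl fun n _ => ?_
    rw [Finset.prod_mul_distrib, ← Finset.sum_neg_distrib, Real.exp_sum, ← norm_prod,
      prod_one_sub_div_alsNode]
  have hP : ‖∏ n ∈ Finset.range N, nodeFactor ε n z‖ =
      ∏ n ∈ Finset.range N, ∏ j, ‖1 - z / pertNode ε n j‖ := by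
    rw [norm_prod]
    exact Finset.prod_congr rfl fun n _ => by rw [nodeFactor, norm_prod]
  have hS := sum_nodeError_le hK1 hr N
  have hexp : ∀ c : ℝ, ∏ n ∈ Finset.range N, ∏ _j : Fin 4, Real.exp (c * nodeError K ‖z‖ n) =
      Real.exp (4 * c * ∑ n ∈ Finset.range N, nodeError K ‖z‖ n) := by
    intro c
    rw [Finset.mul_sum, Real.exp_sum]
    refine Finset.prod_congr rfl fun n _ => ?_
    rw [Finset.prod_const, Finset.card_univ, Fintype.card_fin, ← Real.exp_nat_mul]
    congr 1; push_cast; ring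
  rw [hE, hP]
  constructor
  · calc _ ≤ Real.exp (4 * (-2) * ∑ n ∈ Finset.range N, nodeError K ‖z‖ n) *
          ∏ n ∈ Finset.range N, ∏ j, (‖1 - z / alsNode n j‖ *
            Real.exp (-if n < m then (ε n j).re else 0)) := by
          gcongr; linarith
      _ = ∏ n ∈ Finset.range N, ∏ j, (Real.exp (-2 * nodeError K ‖z‖ n) *
          (‖1 - z / alsNode n j‖ * Real.exp (-if n < m then (ε n j).re else 0))) := by
          rw [← hexp, ← Finset.prod_mul_distrib]
          exact Finset.prod_congr rfl fun n _ => Finset.prod_mul_distrib.symm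
      _ ≤ _ := by
          refine Finset.prod_le_prod (fun _ _ => by positivity) fun n _ =>
            Finset.prod_le_prod (fun _ _ => by positivity) fun j _ => ?_
          rw [neg_mul]; exact (hb n j).1
  · calc _ ≤ ∏ n ∈ Finset.range N, ∏ j, (Real.exp (2 * nodeError K ‖z‖ n) *
          (‖1 - z / alsNode n j‖ * Real.exp (-if n < m then (ε n j).re else 0))) :=
          Finset.prod_le_prod (fun _ _ => by positivity) fun n _ =>
            Finset.prod_le_prod (fun _ _ => by positivity) fun j _ => (hb n j).2
      _ = Real.exp (4 * 2 * ∑ n ∈ Finset.range N, nodeError K ‖z‖ n) *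
          ∏ n ∈ Finset.range N, ∏ j, (‖1 - z / alsNode n j‖ *
            Real.exp (-if n < m then (ε n j).re else 0)) := by
          rw [← hexp, ← Finset.prod_mul_distrib]
          exact Finset.prod_congr rfl fun n _ => Finset.prod_mul_distrib
      _ ≤ _ := mul_le_mul_of_nonneg_right (Real.exp_le_exp.2 (by linarith))
          (Finset.prod_nonneg fun _ _ => Finset.prod_nonneg fun _ _ => by positivity)

/-- One of the two exponentials in the sine dominates the other as soon as `|Im w| ≥ 1`. -/
theorem norm_sin_bounds {w : ℂ} (hw : 1 ≤ |w.im|) :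
    Real.exp |w.im| / 4 ≤ ‖Complex.sin w‖ ∧ ‖Complex.sin w‖ ≤ Real.exp |w.im| := by
  have h1 : ‖Complex.sin w‖ = ‖Complex.exp (-w * Complex.I) - Complex.exp (w * Complex.I)‖ / 2 := by
    rw [Complex.sin, norm_div, norm_mul, Complex.norm_I, mul_one]; simp
  have h2 : ‖Complex.exp (-w * Complex.I)‖ = Real.exp w.im := by
    rw [Complex.norm_exp]; simp
  have h3 : ‖Complex.exp (w * Complex.I)‖ = Real.exp (-w.im) := by
    rw [Complex.norm_exp]; simp
  have h4 : Real.exp (-|w.im|) ≤ Real.exp |w.im| / 2 := by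
    have h5 : 2 ≤ Real.exp (2 * |w.im|) := by linarith [Real.add_one_le_exp (2 * |w.im|)]
    have h6 : Real.exp |w.im| = Real.exp (2 * |w.im|) * Real.exp (-|w.im|) := by
      rw [← Real.exp_add]; congr 1; ring
    rw [h6]; nlinarith [Real.exp_pos (-|w.im|)]
  have h7 := norm_sub_le (Complex.exp (-w * Complex.I)) (Complex.exp (w * Complex.I))
  have h8 := abs_norm_sub_norm_le (Complex.exp (-w * Complex.I)) (Complex.exp (w * Complex.I))
  have h9 := abs_le.1 h8
  rw [h2, h3] at h7 h9
  rw [h1]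
  rcases abs_cases w.im with ⟨ha, _⟩ | ⟨ha, _⟩ <;> rw [ha] at h4 ⊢
  · constructor <;> linarith [Real.exp_pos w.im]
  · rw [neg_neg] at h4
    constructor <;> linarith [Real.exp_pos (-w.im)]

/-- Two-sided estimate of the infinite product near the diagonals. -/
theorem exists_norm_tprod_nodeFactor_bounds {ε : ℕ → Fin 4 → ℂ} {C : ℝ}
    (hε : ∀ n j, ‖ε n j‖ ≤ C / (n + 1)) :
    ∃ M R : ℝ, 0 < M ∧ 2 ≤ R ∧ ∀ z ∈ diagonalSector, R ≤ ‖z‖ →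
      Real.exp (Real.pi / 2 * |(z ^ 2).im| -
        ∑ n ∈ Finset.range ⌊‖z‖ ^ 2⌋₊, ∑ j, (ε n j).re) ≤
          M * (‖z‖ ^ 2 * ‖∏' n, nodeFactor ε n z‖) ∧
      ‖z‖ ^ 2 * ‖∏' n, nodeFactor ε n z‖ ≤ M * Real.exp (Real.pi / 2 * |(z ^ 2).im| -
        ∑ n ∈ Finset.range ⌊‖z‖ ^ 2⌋₊, ∑ j, (ε n j).re) := by
  obtain ⟨K, hK1, hK⟩ := exists_norm_exp_sub_one_le hε
  obtain ⟨K', -, hK'⟩ := exists_norm_nodeFactor_sub_one_le hε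
  refine ⟨8 * Real.exp (352 * K), 16 * K, by positivity, by linarith, fun z hz hr => ?_⟩
  set E := ∑ n ∈ Finset.range ⌊‖z‖ ^ 2⌋₊, ∑ j, (ε n j).re with hE
  have hpi3 := Real.pi_gt_three
  have hpi4 := Real.pi_le_four
  have hlim1 : Tendsto (fun N => ‖∏ n ∈ Finset.range N, nodeFactor ε n z‖) atTop
      (nhds ‖∏' n, nodeFactor ε n z‖) :=
    (multipliable_of_norm_sub_one_le (summable_inv_mul_sqrt K')
      (B := fun r => (1 + max r 0) ^ 4) hK' z).hasProd.tendsto_prod_nat.norm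
  -- Euler's product gives the sine only after multiplication by `π z ^ 2 / 2`, the source of the
  -- factor `‖z‖ ^ 2`.
  have hlim2 : Tendsto (fun N => Real.pi / 2 * ‖z‖ ^ 2 *
      ‖∏ n ∈ Finset.range N, (1 - (z ^ 2 / 2) ^ 2 / ((n : ℂ) + 1) ^ 2)‖) atTop
      (nhds ‖Complex.sin (Real.pi * (z ^ 2 / 2))‖) := by
    refine (Complex.tendsto_euler_sin_prod (z ^ 2 / 2)).norm.congr fun N => ?_
    rw [norm_mul, norm_mul, norm_div, norm_pow, Complex.norm_real,
      Real.norm_of_nonneg Real.pi_pos.le]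
    simp only [Complex.norm_ofNat]
    ring
  have hwim : |((Real.pi : ℂ) * (z ^ 2 / 2)).im| = Real.pi / 2 * |(z ^ 2).im| := by
    rw [Complex.im_ofReal_mul, show z ^ 2 / 2 = ((1 / 2 : ℝ) : ℂ) * z ^ 2 by push_cast; ring,
      Complex.im_ofReal_mul, abs_mul, abs_mul, abs_of_pos Real.pi_pos]
    norm_num; ring
  have hz' : ‖z‖ ^ 2 / 2 ≤ |(z ^ 2).im| := hz
  have hsin := norm_sin_bounds (w := (Real.pi : ℂ) * (z ^ 2 / 2)) (by rw [hwim]; nlinarith)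
  rw [hwim] at hsin
  have hup : Real.pi / 2 * ‖z‖ ^ 2 * ‖∏' n, nodeFactor ε n z‖ ≤ Real.exp (352 * K) *
      (‖Complex.sin (Real.pi * (z ^ 2 / 2))‖ * Real.exp (-E)) := by
    refine le_of_tendsto_of_tendsto (hlim1.const_mul _)
      ((hlim2.mul_const (Real.exp (-E))).const_mul _) ?_
    filter_upwards [eventually_ge_atTop ⌊‖z‖ ^ 2⌋₊] with N hN
    have := (norm_prod_nodeFactor_bounds hK1 hK hz hr hN).2
    rw [← hE] at this
    calc _ ≤ Real.pi / 2 * ‖z‖ ^ 2 * _ := mul_le_mul_of_nonneg_left this (by positivity)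
      _ = _ := by ring
  have hlow : Real.exp (-(352 * K)) *
      (‖Complex.sin (Real.pi * (z ^ 2 / 2))‖ * Real.exp (-E)) ≤
      Real.pi / 2 * ‖z‖ ^ 2 * ‖∏' n, nodeFactor ε n z‖ := by
    refine le_of_tendsto_of_tendsto ((hlim2.mul_const (Real.exp (-E))).const_mul _)
      (hlim1.const_mul _) ?_
    filter_upwards [eventually_ge_atTop ⌊‖z‖ ^ 2⌋₊] with N hN
    have := (norm_prod_nodeFactor_bounds hK1 hK hz hr hN).1
    rw [← hE] at this
    calc _ = Real.pi / 2 * ‖z‖ ^ 2 * _ := by ring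
      _ ≤ _ := mul_le_mul_of_nonneg_left this (by positivity)
  rw [Real.exp_neg, inv_mul_le_iff₀ (by positivity)] at hlow
  rw [sub_eq_add_neg, Real.exp_add]
  set Y := Real.exp (Real.pi / 2 * |(z ^ 2).im|) with hY
  have hE0 := Real.exp_pos (-E)
  have hX : 0 ≤ ‖z‖ ^ 2 * ‖∏' n, nodeFactor ε n z‖ := by positivity
  have hK0 := Real.exp_pos (352 * K)
  have hY0 : 0 < Y := Real.exp_pos _
  constructor
  · calc Y * Real.exp (-E) ≤ 4 * (‖Complex.sin (Real.pi * (z ^ 2 / 2))‖ * Real.exp (-E)) := by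
          nlinarith [hsin.1]
      _ ≤ 4 * (Real.exp (352 * K) * (Real.pi / 2 * ‖z‖ ^ 2 * ‖∏' n, nodeFactor ε n z‖)) := by
          gcongr
      _ = Real.pi * (2 * Real.exp (352 * K) * (‖z‖ ^ 2 * ‖∏' n, nodeFactor ε n z‖)) := by ring
      _ ≤ 4 * (2 * Real.exp (352 * K) * (‖z‖ ^ 2 * ‖∏' n, nodeFactor ε n z‖)) := by gcongr
      _ = _ := by ring
  · calc ‖z‖ ^ 2 * ‖∏' n, nodeFactor ε n z‖
        ≤ Real.pi / 2 * (‖z‖ ^ 2 * ‖∏' n, nodeFactor ε n z‖) :=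
          le_mul_of_one_le_left hX (by linarith)
      _ = Real.pi / 2 * ‖z‖ ^ 2 * ‖∏' n, nodeFactor ε n z‖ := by ring
      _ ≤ _ := hup
      _ ≤ Real.exp (352 * K) * (Y * Real.exp (-E)) := by gcongr; exact hsin.2
      _ ≤ _ := by
        have : 0 ≤ Real.exp (352 * K) * (Y * Real.exp (-E)) := by positivity
        linarith

/-! ### The generating function: its zeros and its size near the diagonals. -/

/-- The entire function with zeros at `μ`, `ν` and at the perturbed points. -/
noncomputable def genFun (ε : ℕ → Fin 4 → ℂ) (μ ν z : ℂ) : ℂ :=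
  (z - μ) * (z - ν) * ∏' n, nodeFactor ε n z

/-- The truncation at 0 makes the majorant monotone on all of `ℝ`, as `differentiable_tprod`
requires. -/
theorem monotone_one_add_max_pow : Monotone fun r : ℝ => (1 + max r 0) ^ 4 := by
  intro a b hab
  have : 0 ≤ max a 0 := le_max_right _ _
  dsimp only
  gcongr

theorem differentiable_genFun {ε : ℕ → Fin 4 → ℂ} {C : ℝ} (hε : ∀ n j, ‖ε n j‖ ≤ C / (n + 1))
    (μ ν : ℂ) : Differentiable ℂ (genFun ε μ ν) := by
  obtain ⟨K, hK0, hK⟩ := exists_norm_nodeFactor_sub_one_le hε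
  have := differentiable_tprod (summable_inv_mul_sqrt K) (fun n => by positivity)
    monotone_one_add_max_pow hK (differentiable_nodeFactor ε)
  unfold genFun
  fun_prop

theorem genFun_eq_zero_iff {ε : ℕ → Fin 4 → ℂ} {C : ℝ} (hε : ∀ n j, ‖ε n j‖ ≤ C / (n + 1))
    {μ ν z : ℂ} : genFun ε μ ν z = 0 ↔ z = μ ∨ z = ν ∨ ∃ n j, z = pertNode ε n j := by
  obtain ⟨K, hK0, hK⟩ := exists_norm_nodeFactor_sub_one_le hε
  rw [genFun, mul_eq_zero, mul_eq_zero, sub_eq_zero, sub_eq_zero, or_assoc]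
  refine or_congr_right (or_congr_right ?_)
  simp only [← nodeFactor_eq_zero_iff]
  constructor
  · intro h
    by_contra! h'
    exact tprod_ne_zero (B := fun r => (1 + max r 0) ^ 4) (summable_inv_mul_sqrt K) hK h' h
  · rintro ⟨n, hn⟩
    rw [← prod_range_mul_tprod (B := fun r => (1 + max r 0) ^ 4) (summable_inv_mul_sqrt K) hK z (n + 1),
      Finset.prod_eq_zero (Finset.self_mem_range_succ n) hn, zero_mul]

theorem analyticOrderAt_eq_one_of_eq_mul {S g : ℂ → ℂ} {w : ℂ} (hg : AnalyticAt ℂ g w)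
    (hgw : g w ≠ 0) (hS : AnalyticAt ℂ S w) (h : ∀ z, S z = (z - w) * g z) :
    analyticOrderAt S w = 1 := by
  rw [show (1 : ℕ∞) = ((1 : ℕ) : ℕ∞) by simp, hS.analyticOrderAt_eq_natCast]
  exact ⟨g, hg, hgw, Eventually.of_forall fun z => by simp [h z]⟩

/-- All zeros of the generating function are simple if the nodes are distinct. -/
theorem analyticOrderAt_genFun {ε : ℕ → Fin 4 → ℂ} {C : ℝ} (hε : ∀ n j, ‖ε n j‖ ≤ C / (n + 1))
    {μ ν : ℂ} (hμν : μ ≠ ν) (hμ : ∀ n j, pertNode ε n j ≠ μ) (hν : ∀ n j, pertNode ε n j ≠ ν)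
    (hinj : ∀ n j n' j', pertNode ε n j = pertNode ε n' j' → n = n' ∧ j = j') {z : ℂ}
    (hz : genFun ε μ ν z = 0) : analyticOrderAt (genFun ε μ ν) z = 1 := by
  obtain ⟨K, hK0, hK⟩ := exists_norm_nodeFactor_sub_one_le hε
  have hSz : AnalyticAt ℂ (genFun ε μ ν) z := (differentiable_genFun hε μ ν).analyticAt z
  have hdP : Differentiable ℂ fun z => ∏' n, nodeFactor ε n z :=
    differentiable_tprod (summable_inv_mul_sqrt K) (fun n => by positivity)
    monotone_one_add_max_pow hK (differentiable_nodeFactor ε)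
  have hP0 : ∀ z, (∀ n j, z ≠ pertNode ε n j) → ∏' n, nodeFactor ε n z ≠ 0 := fun z h =>
    tprod_ne_zero (B := fun r => (1 + max r 0) ^ 4) (summable_inv_mul_sqrt K) hK
      fun n hn => by
        obtain ⟨j, hj⟩ := nodeFactor_eq_zero_iff.1 hn
        exact h n j hj
  rcases (genFun_eq_zero_iff hε).1 hz with rfl | rfl | ⟨n₀, j₀, rfl⟩
  · refine analyticOrderAt_eq_one_of_eq_mul (g := fun w => (w - ν) * ∏' n, nodeFactor ε n w)
      (Differentiable.analyticAt (by fun_prop) _)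
      (mul_ne_zero (sub_ne_zero.2 hμν) (hP0 _ fun n j => (hμ n j).symm)) hSz fun w => ?_
    rw [genFun]; ring
  · refine analyticOrderAt_eq_one_of_eq_mul (g := fun w => (w - μ) * ∏' n, nodeFactor ε n w)
      (Differentiable.analyticAt (by fun_prop) _)
      (mul_ne_zero (sub_ne_zero.2 hμν.symm) (hP0 _ fun n j => (hν n j).symm)) hSz fun w => ?_
    rw [genFun]; ring
  · set lam := pertNode ε n₀ j₀ with hlam
    -- Replacing the factor of index `n₀` by 1 leaves a convergent product, nonzero at `lam` because
    -- the nodes are distinct.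
    set P' : ℕ → ℂ → ℂ := fun n w => Function.update (fun m => nodeFactor ε m w) n₀ 1 n with hP'
    have hK' : ∀ n w, ‖P' n w - 1‖ ≤
        K / (((n : ℝ) + 1) * Real.sqrt (n + 1)) * (1 + max ‖w‖ 0) ^ 4 := by
      intro n w
      by_cases hn : n = n₀
      · subst hn; simp only [hP', Function.update_self, sub_self, norm_zero]; positivity
      · simp only [hP', Function.update_of_ne hn]; exact hK n w
    have hd' : ∀ n, Differentiable ℂ (P' n) := by
      intro n
      by_cases hn : n = n₀
      · subst hn; simp only [hP', Function.update_self]; fun_prop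
      · simp only [hP', Function.update_of_ne hn]; exact differentiable_nodeFactor ε n
    have hdT := differentiable_tprod (summable_inv_mul_sqrt K) (fun n => by positivity)
      monotone_one_add_max_pow hK' hd'
    have hsplit : ∀ w, ∏' n, nodeFactor ε n w = nodeFactor ε n₀ w * ∏' n, P' n w := by
      intro w
      have h1 := Multipliable.tprod_eq_mul_tprod_ite' (f := fun m => nodeFactor ε m w) n₀
        (multipliable_of_norm_sub_one_le (B := fun r => (1 + max r 0) ^ 4) (summable_inv_mul_sqrt K) hK' w)
      rw [h1]
      congr 1
      refine tprod_congr fun n => ?_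
      by_cases hn : n = n₀
      · subst hn; simp [hP']
      · simp [hP', hn]
    refine analyticOrderAt_eq_one_of_eq_mul
      (g := fun w => -lam⁻¹ * ((w - μ) * (w - ν) *
        ((∏ j ∈ Finset.univ.erase j₀, (1 - w / pertNode ε n₀ j)) * ∏' n, P' n w)))
      (Differentiable.analyticAt (by fun_prop) _) ?_ hSz fun w => ?_
    · have hl0 : lam ≠ 0 := pertNode_ne_zero ε n₀ j₀
      refine mul_ne_zero (neg_ne_zero.2 (inv_ne_zero hl0))
        (mul_ne_zero (mul_ne_zero (sub_ne_zero.2 (hμ _ _)) (sub_ne_zero.2 (hν _ _)))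
          (mul_ne_zero (Finset.prod_ne_zero_iff.2 fun j hj => ?_) (tprod_ne_zero
            (B := fun r => (1 + max r 0) ^ 4) (summable_inv_mul_sqrt K) hK' fun n => ?_)))
      · rw [sub_ne_zero, ne_comm, Ne, div_eq_one_iff_eq (pertNode_ne_zero ε n₀ j)]
        exact fun h => (Finset.mem_erase.1 hj).1 (hinj _ _ _ _ h).2.symm
      · by_cases hn : n = n₀
        · subst hn; simp [hP']
        · simp only [hP', Function.update_of_ne hn, ne_eq, nodeFactor_eq_zero_iff, not_exists]
          exact fun j h => hn (hinj _ _ _ _ h).1.symm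
    · rw [genFun, hsplit, nodeFactor, ← Finset.mul_prod_erase _ _ (Finset.mem_univ j₀), ← hlam]
      have hl0 : lam ≠ 0 := pertNode_ne_zero ε n₀ j₀
      have : 1 - w / lam = (w - lam) * -lam⁻¹ := by field_simp; ring
      rw [this]; ring

/-- Removing a simple zero `w` of an entire function by passing to its divided difference. -/
theorem dslope_zeros {S : ℂ → ℂ} (hS : Differentiable ℂ S)
    (hord : ∀ z, S z = 0 → analyticOrderAt S z = 1) {w : ℂ} (hw : S w = 0) :
    Differentiable ℂ (dslope S w) ∧ (∀ z, S z = (z - w) * dslope S w z) ∧ dslope S w w ≠ 0 ∧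
      ∀ z, z ≠ w → S z = 0 → analyticOrderAt (dslope S w) z = 1 := by
  have hd : Differentiable ℂ (dslope S w) := by
    rw [← differentiableOn_univ]
    exact (Complex.differentiableOn_dslope univ_mem).2 hS.differentiableOn
  have hmul : ∀ z, S z = (z - w) * dslope S w z := by
    intro z
    have := sub_smul_dslope S w z
    rw [hw, sub_zero, smul_eq_mul] at this
    exact this.symm
  have hfun : S = (fun z => z - w) * dslope S w := funext hmul
  have hlin : ∀ z, AnalyticAt ℂ (fun z : ℂ => z - w) z := fun z => by fun_prop
  have hmulord : ∀ z, analyticOrderAt S z =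
      analyticOrderAt (fun z => z - w) z + analyticOrderAt (dslope S w) z := by
    intro z
    conv_lhs => rw [hfun]
    exact analyticOrderAt_mul (hlin z) (hd.analyticAt z)
  refine ⟨hd, hmul, fun h0 => ?_, fun z hz hSz => ?_⟩
  · have h1 := hmulord w
    have h2 : analyticOrderAt (fun z : ℂ => z - w) w = 1 :=
      analyticOrderAt_eq_one_of_eq_mul (g := fun _ => 1) analyticAt_const one_ne_zero (hlin w)
        fun z => by ring
    rw [hord w hw, h2] at h1
    have h3 : analyticOrderAt (dslope S w) w ≠ 0 := fun h =>
      (hd.analyticAt w).analyticOrderAt_eq_zero.1 h h0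
    have h4 : (1 : ℕ∞) ≤ analyticOrderAt (dslope S w) w := Order.one_le_iff_ne_zero.2 h3
    have h5 : (1 + 1 : ℕ∞) ≤ 1 := by
      calc (1 + 1 : ℕ∞) ≤ 1 + analyticOrderAt (dslope S w) w := by gcongr
        _ = 1 := h1.symm
    norm_num at h5
  · have h1 := hmulord z
    have h2 : analyticOrderAt (fun z : ℂ => z - w) z = 0 :=
      (hlin z).analyticOrderAt_eq_zero.2 (sub_ne_zero.2 hz)
    rw [h2, zero_add, hord z hSz] at h1
    exact h1.symm

/-- Two-sided estimate of the generating function near the diagonals. -/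
theorem exists_norm_genFun_bounds {ε : ℕ → Fin 4 → ℂ} {C : ℝ} (hε : ∀ n j, ‖ε n j‖ ≤ C / (n + 1))
    (μ ν : ℂ) {b : ℝ} (hb0 : 0 ≤ b)
    (hb : ∀ᶠ m : ℕ in atTop, |∑ n ∈ Finset.range m, ∑ j, (ε n j).re| ≤ b * Real.log m) :
    ∃ M R : ℝ, 0 < M ∧ 2 ≤ R ∧ ∀ z ∈ diagonalSector, R ≤ ‖z‖ →
      Real.exp (Real.pi / 2 * |(z ^ 2).im|) ≤ M * ‖z‖ ^ (2 * b) * ‖genFun ε μ ν z‖ ∧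
      ‖genFun ε μ ν z‖ ≤ M * ‖z‖ ^ (2 * b) * Real.exp (Real.pi / 2 * |(z ^ 2).im|) := by
  obtain ⟨M, R, hM, hR, h⟩ := exists_norm_tprod_nodeFactor_bounds hε
  obtain ⟨N, hN⟩ := eventually_atTop.1 hb
  -- `N + 1` makes the logarithmic bound valid at the index `⌊‖z‖ ^ 2⌋`; the last term makes `‖z -
  -- μ‖` and `‖z - ν‖` comparable to `‖z‖`, so the two extra zeros match the factor `‖z‖ ^ 2`.
  refine ⟨4 * M, max R (max (N + 1) (2 * (‖μ‖ + ‖ν‖))), by positivity, hR.trans (le_max_left _ _),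
    fun z hz hr => ?_⟩
  have hr1 : R ≤ ‖z‖ := (le_max_left _ _).trans hr
  have hr2 : (N : ℝ) + 1 ≤ ‖z‖ := (le_max_left _ _).trans ((le_max_right _ _).trans hr)
  have hr3 : 2 * (‖μ‖ + ‖ν‖) ≤ ‖z‖ := (le_max_right _ _).trans ((le_max_right _ _).trans hr)
  obtain ⟨h1, h2⟩ := h z hz hr1
  set r := ‖z‖ with hrdef
  have hr0 : 0 < r := by linarith
  set E := ∑ n ∈ Finset.range ⌊r ^ 2⌋₊, ∑ j, (ε n j).re with hE
  -- The cut is at `r ^ 2`, so `b log m` becomes `2 b log r`.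
  have hEb : |E| ≤ Real.log r * (2 * b) := by
    have hNm : N ≤ ⌊r ^ 2⌋₊ := by
      apply Nat.le_floor
      nlinarith
    have hm0 : 0 < ⌊r ^ 2⌋₊ := by rw [Nat.floor_pos]; nlinarith
    refine (hN _ hNm).trans ?_
    have h3 : Real.log (⌊r ^ 2⌋₊ : ℝ) ≤ Real.log (r ^ 2) :=
      Real.log_le_log (by exact_mod_cast hm0) (Nat.floor_le (by positivity))
    rw [Real.log_pow] at h3
    push_cast at h3
    nlinarith
  have hEabs := abs_le.1 hEb
  have hrp : r ^ (2 * b) = Real.exp (Real.log r * (2 * b)) := Real.rpow_def_of_pos hr0 _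
  have hup1 : ‖z - μ‖ ≤ 2 * r := (norm_sub_le _ _).trans (by
    have := norm_nonneg ν; have := norm_nonneg μ; linarith)
  have hup2 : ‖z - ν‖ ≤ 2 * r := (norm_sub_le _ _).trans (by
    have := norm_nonneg ν; have := norm_nonneg μ; linarith)
  have hlo1 : r / 2 ≤ ‖z - μ‖ := by
    have := norm_sub_norm_le z μ; have := norm_nonneg ν; linarith
  have hlo2 : r / 2 ≤ ‖z - ν‖ := by
    have := norm_sub_norm_le z ν; have := norm_nonneg μ; linarith
  set T := ‖∏' n, nodeFactor ε n z‖ with hT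
  have hT0 : 0 ≤ T := norm_nonneg _
  have hG : ‖genFun ε μ ν z‖ = ‖z - μ‖ * ‖z - ν‖ * T := by rw [genFun, norm_mul, norm_mul]
  set Y := Real.exp (Real.pi / 2 * |(z ^ 2).im|) with hY
  have hY0 : 0 < Y := Real.exp_pos _
  rw [sub_eq_add_neg, Real.exp_add, ← hY] at h1 h2
  have hE1 : Real.exp (-E) ≤ r ^ (2 * b) := by
    rw [hrp]; exact Real.exp_le_exp.2 (by linarith)
  have hE2 : 1 ≤ r ^ (2 * b) * Real.exp (-E) := by
    rw [hrp, ← Real.exp_add, Real.one_le_exp_iff]; linarith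
  have hrb : 0 < r ^ (2 * b) := Real.rpow_pos_of_pos hr0 _
  rw [hG]
  constructor
  · calc Y ≤ (r ^ (2 * b) * Real.exp (-E)) * Y := le_mul_of_one_le_left hY0.le hE2
      _ = r ^ (2 * b) * (Y * Real.exp (-E)) := by ring
      _ ≤ r ^ (2 * b) * (M * (r ^ 2 * T)) := by gcongr
      _ = 4 * M * r ^ (2 * b) * ((r / 2) * (r / 2) * T) := by ring
      _ ≤ _ := by gcongr
  · calc ‖z - μ‖ * ‖z - ν‖ * T ≤ (2 * r) * (2 * r) * T := by gcongr
      _ = 4 * (r ^ 2 * T) := by ring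
      _ ≤ 4 * (M * (Y * Real.exp (-E))) := by gcongr
      _ ≤ 4 * (M * (Y * r ^ (2 * b))) := by gcongr
      _ = _ := by ring

/-! ### Rotated sectors, and growth of the generating function near the axes. -/

/-- Rotations by powers of `i` carry the sector `|arg z| ≤ π / 4` over the whole punctured plane.
They preserve `‖z‖` and `|Im z²|`, so every estimate can be made in one sector. -/
theorem exists_eq_I_pow_mul_exp {z : ℂ} (hz : z ≠ 0) :
    ∃ (k : ℕ) (ζ : ℂ), |ζ.im| ≤ Real.pi / 4 ∧ z = Complex.I ^ k * Complex.exp ζ := by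
  have hl : Complex.exp (Complex.log z) = z := Complex.exp_log hz
  have him : (Complex.log z).im = z.arg := Complex.log_im z
  have h1 := Complex.neg_pi_lt_arg z
  have h2 := Complex.arg_le_pi z
  have hpi := Real.pi_pos
  have key : ∀ (k : ℕ) (t : ℝ), Complex.I ^ k * Complex.exp (t * Complex.I) = 1 →
      |z.arg + t| ≤ Real.pi / 4 →
      ∃ (k : ℕ) (ζ : ℂ), |ζ.im| ≤ Real.pi / 4 ∧ z = Complex.I ^ k * Complex.exp ζ := by
    intro k t ht hle
    refine ⟨k, Complex.log z + t * Complex.I, ?_, ?_⟩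
    · simpa [him] using hle
    · rw [Complex.exp_add, hl, mul_left_comm, ht, mul_one]
  have e1 : Complex.exp ((Real.pi / 2 : ℝ) * Complex.I) = Complex.I := by
    push_cast; exact Complex.exp_pi_div_two_mul_I
  have e2 : Complex.exp ((-(Real.pi / 2) : ℝ) * Complex.I) = -Complex.I := by
    push_cast; rw [← neg_div]; exact Complex.exp_neg_pi_div_two_mul_I
  have e3 : Complex.exp ((Real.pi : ℝ) * Complex.I) = -1 := Complex.exp_pi_mul_I
  have e4 : Complex.exp ((-Real.pi : ℝ) * Complex.I) = -1 := by
    push_cast; rw [neg_mul, Complex.exp_neg, Complex.exp_pi_mul_I]; norm_num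
  by_cases c1 : z.arg ≤ -(3 * Real.pi / 4)
  · exact key 2 Real.pi (by rw [e3]; simp) (abs_le.2 ⟨by linarith, by linarith⟩)
  by_cases c2 : z.arg ≤ -(Real.pi / 4)
  · exact key 3 (Real.pi / 2) (by rw [e1, Complex.I_pow_three]; simp)
      (abs_le.2 ⟨by linarith, by linarith⟩)
  by_cases c3 : z.arg ≤ Real.pi / 4
  · exact key 0 0 (by simp) (abs_le.2 ⟨by linarith, by linarith⟩)
  by_cases c4 : z.arg ≤ 3 * Real.pi / 4
  · exact key 1 (-(Real.pi / 2)) (by rw [e2]; simp)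
      (abs_le.2 ⟨by linarith, by linarith⟩)
  · exact key 2 (-Real.pi) (by rw [e4]; simp) (abs_le.2 ⟨by linarith, by linarith⟩)

theorem norm_I_pow_mul_exp (k : ℕ) (ζ : ℂ) : ‖Complex.I ^ k * Complex.exp ζ‖ = Real.exp ζ.re := by
  rw [norm_mul, norm_pow, Complex.norm_I, one_pow, one_mul, Complex.norm_exp]

theorem abs_im_sq_I_pow_mul_exp (k : ℕ) (ζ : ℂ) :
    |((Complex.I ^ k * Complex.exp ζ) ^ 2).im| = Real.exp ζ.re ^ 2 * |Real.sin (2 * ζ.im)| := by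
  have h1 : (Complex.I ^ k * Complex.exp ζ) ^ 2 =
      (((-1 : ℝ) ^ k : ℝ) : ℂ) * Complex.exp (2 * ζ) := by
    rw [mul_pow, ← pow_mul, mul_comm k 2, pow_mul, Complex.I_sq, ← Complex.exp_nat_mul]
    push_cast; rfl
  rw [h1, Complex.im_ofReal_mul, abs_mul, abs_pow, abs_neg, abs_one, one_pow, one_mul,
    Complex.exp_im, abs_mul, abs_of_pos (Real.exp_pos _), ← Real.exp_nat_mul]
  simp

theorem abs_sin_two_mul {φ : ℝ} (h2 : |φ| ≤ Real.pi / 4) :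
    |Real.sin (2 * φ)| = Real.sin (2 * |φ|) := by
  rw [Real.abs_sin_eq_sin_abs_of_abs_le_pi, abs_mul, abs_two]
  rw [abs_mul, abs_two]
  linarith [Real.pi_pos]

/-- The constant `1 / 2` in `diagonalSector` is `sin (2 · π / 12)`, hence the angle `π / 12` used
from here on. -/
theorem I_pow_mul_exp_mem_diagonalSector (k : ℕ) {ζ : ℂ} (h1 : Real.pi / 12 ≤ |ζ.im|)
    (h2 : |ζ.im| ≤ Real.pi / 4) : Complex.I ^ k * Complex.exp ζ ∈ diagonalSector := by
  change ‖_‖ ^ 2 / 2 ≤ |_|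
  rw [norm_I_pow_mul_exp, abs_im_sq_I_pow_mul_exp, abs_sin_two_mul h2]
  have h3 : Real.sin (Real.pi / 6) ≤ Real.sin (2 * |ζ.im|) :=
    Real.sin_le_sin_of_le_of_le_pi_div_two (by linarith [Real.pi_pos]) (by linarith) (by linarith)
  rw [Real.sin_pi_div_six] at h3
  have := Real.exp_pos ζ.re
  nlinarith [pow_pos this 2]

theorem abs_im_sq_le (z : ℂ) : |(z ^ 2).im| ≤ ‖z‖ ^ 2 := by
  rw [← norm_pow]; exact Complex.abs_im_le_norm _

/-- Compactness takes care of the ball, because the comparison function is at least 1. -/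
theorem exists_forall_norm_le_of_outside_ball {G : ℂ → ℂ} (hG : Continuous G) {s : Set ℂ} {Φ : ℂ → ℝ}
    (hΦ : ∀ z ∈ s, 1 ≤ Φ z) {M R : ℝ} (h : ∀ z ∈ s, R ≤ ‖z‖ → ‖G z‖ ≤ M * Φ z) :
    ∃ C, 0 ≤ C ∧ ∀ z ∈ s, ‖G z‖ ≤ C * Φ z := by
  obtain ⟨K, hK⟩ := (isCompact_closedBall (0:ℂ) R).exists_bound_of_continuousOn hG.continuousOn
  refine ⟨max |K| M, le_max_of_le_left (abs_nonneg _), fun z hz => ?_⟩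
  have h1 := hΦ z hz
  rcases le_total R ‖z‖ with hr | hr
  · refine (h z hz hr).trans ?_
    gcongr
    exact le_max_right _ _
  · have h2 := hK z (by simpa using hr)
    have h3 : |K| ≤ max |K| M := le_max_left _ _
    nlinarith [le_abs_self K, abs_nonneg K]

/-- Puts growth bounds into the form of the Phragmén–Lindelöf hypothesis, where only the order `c`
matters. -/
theorem pow_mul_exp_growth {C b c : ℝ} (hC : 0 ≤ C) (hb : 0 ≤ b) (m : ℕ) {k : ℕ} (hk : 1 ≤ k)
    (hkc : (k : ℝ) ≤ c) : ∃ A B : ℝ, 0 ≤ B ∧ ∀ x : ℝ,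
      C * (1 + Real.exp x) ^ m * Real.exp (b * Real.exp x ^ k) ≤
        A * Real.exp (B * Real.exp (c * x)) := by
  refine ⟨C * m.factorial * Real.exp (b + 3), b + 1, by linarith, fun x => ?_⟩
  set r := Real.exp x with hr
  have hr0 : 0 < r := Real.exp_pos x
  have h1 : (1 + r) ^ m ≤ m.factorial * Real.exp (1 + r) := by
    have := Real.pow_div_factorial_le_exp (1 + r) (by positivity) m
    rwa [div_le_iff₀ (by positivity), mul_comm] at this
  have hpow : ∀ j : ℕ, 1 ≤ j → j ≤ k → r ^ j ≤ 1 + Real.exp (c * x) := by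
    intro j hj hjk
    rcases le_total x 0 with hx | hx
    · have : r ^ j ≤ 1 := pow_le_one₀ hr0.le (Real.exp_le_one_iff.2 hx)
      linarith [Real.exp_pos (c * x)]
    · rw [hr, ← Real.exp_nat_mul]
      have : Real.exp (j * x) ≤ Real.exp (c * x) := by
        apply Real.exp_le_exp.2
        have : (j : ℝ) ≤ k := by exact_mod_cast hjk
        nlinarith
      linarith
  have h2 := hpow 1 le_rfl hk
  have h3 := hpow k hk le_rfl
  rw [pow_one] at h2
  calc C * (1 + r) ^ m * Real.exp (b * r ^ k)
      ≤ C * (m.factorial * Real.exp (1 + r)) * Real.exp (b * r ^ k) := by gcongr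
    _ = C * m.factorial * Real.exp (1 + r + b * r ^ k) := by rw [Real.exp_add (1 + r)]; ring
    _ ≤ C * m.factorial * Real.exp (b + 3 + (b + 1) * Real.exp (c * x)) := by
        refine mul_le_mul_of_nonneg_left (Real.exp_le_exp.2 ?_) (by positivity)
        nlinarith
    _ = _ := by rw [Real.exp_add (b + 3)]; ring

theorem one_add_pow_four_le {r : ℝ} (hr : 0 ≤ r) : (1 + r) ^ 4 ≤ 16 * (1 + r ^ 4) := by
  rcases le_total r 1 with h | h
  · have : (1 + r) ^ 4 ≤ 2 ^ 4 := pow_le_pow_left₀ (by linarith) (by linarith) 4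
    have : 0 ≤ r ^ 4 := by positivity
    linarith
  · have : (1 + r) ^ 4 ≤ (2 * r) ^ 4 := pow_le_pow_left₀ (by linarith) (by linarith) 4
    have h2 : (2 * r) ^ 4 = 16 * r ^ 4 := by ring
    linarith

theorem cos_pi_div_six_ge : 5 / 6 ≤ Real.cos (Real.pi / 6) := by
  rw [Real.cos_pi_div_six]
  have : (5 / 3 : ℝ) ≤ Real.sqrt 3 := Real.le_sqrt_of_sq_le (by norm_num)
  linarith

theorem rpow_le_one_add {x t : ℝ} (hx : 0 ≤ x) (ht0 : 0 ≤ t) (ht : t ≤ 1) : x ^ t ≤ 1 + x := by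
  calc x ^ t ≤ (1 + x) ^ t := Real.rpow_le_rpow hx (by linarith) ht0
    _ ≤ (1 + x) ^ (1 : ℝ) := Real.rpow_le_rpow_of_exponent_le (by linarith) ht
    _ = 1 + x := Real.rpow_one _

/-- Order four is not sharp, but it is below the critical order 6 of a sector of half-angle `π /
12`; it serves only as an a priori bound. -/
theorem exists_norm_genFun_le_crude {ε : ℕ → Fin 4 → ℂ} {C : ℝ} (hε : ∀ n j, ‖ε n j‖ ≤ C / (n + 1))
    (μ ν : ℂ) : ∃ A b : ℝ, 0 ≤ A ∧ 0 ≤ b ∧ ∀ z, ‖genFun ε μ ν z‖ ≤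
      A * (1 + ‖z‖) ^ 2 * Real.exp (b * ‖z‖ ^ 4) := by
  obtain ⟨K, hK0, hK⟩ := exists_norm_nodeFactor_sub_one_le hε
  set s := ∑' n : ℕ, K / (((n : ℝ) + 1) * Real.sqrt (n + 1)) with hs
  have hs0 : 0 ≤ s := tsum_nonneg fun n => by positivity
  refine ⟨(1 + ‖μ‖) * (1 + ‖ν‖) * Real.exp (16 * s), 16 * s, by positivity, by positivity,
    fun z => ?_⟩
  have h1 := norm_tprod_le (B := fun r => (1 + max r 0) ^ 4) (summable_inv_mul_sqrt K) hK z
  rw [← hs, max_eq_left (norm_nonneg z)] at h1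
  have h2 := one_add_pow_four_le (norm_nonneg z)
  have h3 : ∀ w : ℂ, ‖z - w‖ ≤ (1 + ‖w‖) * (1 + ‖z‖) := fun w =>
    (norm_sub_le _ _).trans (by nlinarith [norm_nonneg z, norm_nonneg w])
  rw [genFun, norm_mul, norm_mul]
  calc _ ≤ ((1 + ‖μ‖) * (1 + ‖z‖)) * ((1 + ‖ν‖) * (1 + ‖z‖)) * Real.exp (s * (16 * (1 + ‖z‖ ^ 4))) := by
        gcongr
        · exact h3 μ
        · exact h3 ν
        · exact h1.trans (Real.exp_le_exp.2 (by gcongr))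
    _ = _ := by
        rw [show s * (16 * (1 + ‖z‖ ^ 4)) = 16 * s + 16 * s * ‖z‖ ^ 4 by ring, Real.exp_add]; ring

/-- Growth of the generating function in the sectors around the coordinate axes. -/
theorem exists_norm_genFun_le_sector {ε : ℕ → Fin 4 → ℂ} {C : ℝ}
    (hε : ∀ n j, ‖ε n j‖ ≤ C / (n + 1)) (μ ν : ℂ) {M R t : ℝ} (hM : 0 < M) (ht0 : 0 ≤ t)
    (ht : t ≤ 1) (hS : ∀ z ∈ diagonalSector, R ≤ ‖z‖ → ‖genFun ε μ ν z‖ ≤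
      M * ‖z‖ ^ t * Real.exp (Real.pi / 2 * |(z ^ 2).im|)) :
    ∃ A : ℝ, 0 ≤ A ∧ ∀ (k : ℕ) (ζ : ℂ), |ζ.im| ≤ Real.pi / 12 →
      ‖genFun ε μ ν (Complex.I ^ k * Complex.exp ζ)‖ ≤
        A * (1 + Real.exp ζ.re) * Real.exp (3 / 10 * Real.pi * Real.exp ζ.re ^ 2) := by
  have hpi := Real.pi_pos
  have hdS := differentiable_genFun hε μ ν
  obtain ⟨A₁, hA₁, h1⟩ := exists_forall_norm_le_of_outside_ball hdS.continuous
    (s := diagonalSector) (Φ := fun z => (1 + ‖z‖) * Real.exp (Real.pi / 2 * |(z ^ 2).im|))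
    (fun z _ => by
      have h1 : 1 ≤ Real.exp (Real.pi / 2 * |(z ^ 2).im|) := Real.one_le_exp_iff.2 (by positivity)
      nlinarith [norm_nonneg z]) (M := M) (R := R) (fun z hz hr => by
      refine (hS z hz hr).trans ?_
      rw [← mul_assoc]
      gcongr
      exact rpow_le_one_add (norm_nonneg z) ht0 ht)
  obtain ⟨A₂, b, hA₂, hb, h2⟩ := exists_norm_genFun_le_crude hε μ ν
  obtain ⟨A, B, hB, hAB⟩ := pow_mul_exp_growth hA₂ hb 2 (k := 4) (c := 5) (by norm_num)
    (by norm_num)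
  refine ⟨2 * A₁, by positivity, fun k ζ hζ => ?_⟩
  have hα : ((2 : ℕ) : ℝ) * (Real.pi / 12) = Real.pi / 6 := by push_cast; ring
  have h3 := norm_le_of_sector_growth (G := fun z => genFun ε μ ν (Complex.I ^ k * z))
    (hdS.comp (by fun_prop)) (α := Real.pi / 12) (c := 5) (A := A) (B := B) (b := Real.pi / 4)
    (C := A₁) (k := 2) (m := 1) (by positivity) (by linarith) (by rw [hα]; linarith)
    (by rw [lt_div_iff₀ (by positivity)]; linarith) (by norm_num) hB (by positivity) hA₁
    (fun ζ _ => by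
      refine (h2 _).trans ?_
      rw [norm_I_pow_mul_exp]
      exact hAB ζ.re)
    (fun ζ hζ => by
      refine (h1 _ (I_pow_mul_exp_mem_diagonalSector k hζ.ge (by rw [hζ]; linarith))).trans ?_
      rw [norm_I_pow_mul_exp, abs_im_sq_I_pow_mul_exp, abs_sin_two_mul (by rw [hζ]; linarith), hζ,
        show 2 * (Real.pi / 12) = Real.pi / 6 by ring, Real.sin_pi_div_six, pow_one, ← mul_assoc]
      apply le_of_eq
      congr 2; ring) hζ
  refine h3.trans ?_
  rw [pow_one, pow_one, hα]
  gcongr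
  -- On the boundary rays `|Im z²| = r² / 2`, giving the rate `π / 4`; division by `cos (π / 6) ≥ 5
  -- / 6` yields `3 π / 10`, still below the rate `π / 2` of the weight.
  rw [div_le_iff₀ (by linarith [cos_pi_div_six_ge])]
  nlinarith [cos_pi_div_six_ge]

/-! ### Quotients by the generating function are polynomials. -/

theorem one_le_finset_prod {ι : Type*} {s : Finset ι} {f : ι → ℝ} (h : ∀ i ∈ s, 1 ≤ f i) :
    1 ≤ ∏ i ∈ s, f i := by
  calc (1 : ℝ) = ∏ _i ∈ s, 1 := by simp
    _ ≤ _ := Finset.prod_le_prod (fun _ _ => zero_le_one) h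

/-- Ensures that `h` times a tail of the product, being `f` divided by this polynomial, inherits the
growth of `f`. -/
theorem exists_one_le_norm_partial_genFun (ε : ℕ → Fin 4 → ℂ) (μ ν : ℂ) (N : ℕ) :
    ∃ R : ℝ, ∀ z : ℂ, R ≤ ‖z‖ →
      1 ≤ ‖(z - μ) * (z - ν) * ∏ n ∈ Finset.range N, nodeFactor ε n z‖ := by
  set s := ∑ n ∈ Finset.range N, ∑ j, 2 * ‖pertNode ε n j‖ with hs
  have hs0 : 0 ≤ s := Finset.sum_nonneg fun n _ => Finset.sum_nonneg fun j _ => by positivity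
  refine ⟨1 + ‖μ‖ + ‖ν‖ + s, fun z hz => ?_⟩
  have h1 : 1 ≤ ‖z - μ‖ := by
    have := norm_sub_norm_le z μ; have := norm_nonneg ν; linarith
  have h2 : 1 ≤ ‖z - ν‖ := by
    have := norm_sub_norm_le z ν; have := norm_nonneg μ; linarith
  have h3 : 1 ≤ ∏ n ∈ Finset.range N, ‖nodeFactor ε n z‖ := by
    refine one_le_finset_prod fun n hn => ?_
    rw [nodeFactor, norm_prod]
    refine one_le_finset_prod fun j _ => ?_
    have h4 : 2 * ‖pertNode ε n j‖ ≤ s :=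
      (Finset.single_le_sum (f := fun j => 2 * ‖pertNode ε n j‖) (fun j _ => by positivity)
        (Finset.mem_univ j)).trans
        (Finset.single_le_sum (f := fun n => ∑ j, 2 * ‖pertNode ε n j‖)
          (fun n _ => Finset.sum_nonneg fun j _ => by positivity) hn)
    have h5 : 0 < ‖pertNode ε n j‖ := norm_pos_iff.2 (pertNode_ne_zero ε n j)
    have h6 : 2 ≤ ‖z / pertNode ε n j‖ := by
      rw [norm_div, le_div_iff₀ h5]
      have := norm_nonneg μ; have := norm_nonneg ν; linarith
    have h7 := norm_sub_norm_le (z / pertNode ε n j) 1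
    rw [norm_sub_rev, norm_one] at h7
    linarith
  rw [norm_mul, norm_mul, norm_prod]
  exact one_le_mul_of_one_le_of_one_le (one_le_mul_of_one_le_of_one_le h1 h2) h3

theorem tail_tsum_le {u : ℕ → ℝ} (hu : Summable u) (hu0 : ∀ n, 0 ≤ u n) (N : ℕ) :
    ∑' n, u (n + N) ≤ ∑' n, u n := by
  rw [← hu.sum_add_tsum_nat_add N]
  have : 0 ≤ ∑ i ∈ Finset.range N, u i := Finset.sum_nonneg fun n _ => hu0 n
  linarith

/-- First growth estimate for a quotient by the generating function, near the axes. -/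
theorem exists_norm_quotient_le_exp_pow_four {ε : ℕ → Fin 4 → ℂ} {C : ℝ}
    (hε : ∀ n j, ‖ε n j‖ ≤ C / (n + 1)) {μ ν : ℂ} {f h : ℂ → ℂ} (hh : Differentiable ℂ h)
    (hfh : ∀ z, f z = genFun ε μ ν z * h z) {Cf : ℝ}
    (hf : ∀ z, ‖f z‖ ≤ Cf * (1 + ‖z‖) ^ 2 * Real.exp (Real.pi / 2 * ‖z‖ ^ 2))
    {A : ℝ} (hA : 0 ≤ A) (hD : ∀ z ∈ diagonalSector, ‖h z‖ ≤
      A * ((1 + ‖z‖) ^ 3 * Real.exp (Real.pi / 2 * (‖z‖ ^ 2 - |(z ^ 2).im|)))) :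
    ∃ A' b : ℝ, 0 ≤ A' ∧ 0 ≤ b ∧ ∀ (k : ℕ) (ζ : ℂ), |ζ.im| ≤ Real.pi / 12 →
      ‖h (Complex.I ^ k * Complex.exp ζ)‖ ≤
        A' * (1 + Real.exp ζ.re) ^ 3 * Real.exp (b * Real.exp ζ.re ^ 4) := by
  have hpi := Real.pi_pos
  obtain ⟨K, hK0, hK⟩ := exists_norm_nodeFactor_sub_one_le hε
  set u : ℕ → ℝ := fun n => K / (((n : ℝ) + 1) * Real.sqrt (n + 1)) with hudef
  have hu : Summable u := summable_inv_mul_sqrt K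
  have hu0 : ∀ n, 0 ≤ u n := fun n => by simp only [hudef]; positivity
  set s := ∑' n, u n with hs
  have hs0 : 0 ≤ s := tsum_nonneg hu0
  set B : ℝ → ℝ := fun r => (1 + max r 0) ^ 4 with hBdef
  -- The product `h * T N` is `f` divided by a polynomial, hence of order two with constants
  -- depending on `N`. This admits Phragmén–Lindelöf, while the bound on the boundary rays, and so
  -- the conclusion, is uniform in `N`.
  set T : ℕ → ℂ → ℂ := fun N z => ∏' n, nodeFactor ε (n + N) z with hT
  have hTd : ∀ N, Differentiable ℂ (T N) := fun N =>
    differentiable_tprod (P := fun n => nodeFactor ε (n + N)) (u := fun n => u (n + N)) (B := B)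
      ((summable_nat_add_iff N).2 hu) (fun n => hu0 _) monotone_one_add_max_pow
      (fun n z => hK _ z) fun n => differentiable_nodeFactor ε _
  have hTn : ∀ N z, ‖T N z‖ ≤ Real.exp (s * (1 + ‖z‖) ^ 4) := by
    intro N z
    refine (norm_tprod_le (P := fun n => nodeFactor ε (n + N)) (u := fun n => u (n + N)) (B := B)
      ((summable_nat_add_iff N).2 hu) (fun n z => hK _ z) z).trans ?_
    simp only [hBdef, max_eq_left (norm_nonneg z)]
    have := tail_tsum_le hu hu0 N
    gcongr
  have hTlim : ∀ z, Tendsto (fun N => T N z) atTop (nhds 1) := fun z =>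
    tendsto_tprod_tail (B := B) hu hK z
  set b : ℝ := Real.pi / 2 + 16 * s with hb
  set A₁ : ℝ := A * Real.exp b with hA₁
  have hα : ((4 : ℕ) : ℝ) * (Real.pi / 12) = Real.pi / 3 := by push_cast; ring
  have hbound : ∀ (N k : ℕ) (ζ : ℂ), |ζ.im| ≤ Real.pi / 12 →
      ‖h (Complex.I ^ k * Complex.exp ζ) * T N (Complex.I ^ k * Complex.exp ζ)‖ ≤
        2 ^ 3 * A₁ * (1 + Real.exp ζ.re) ^ 3 * Real.exp (b / Real.cos (Real.pi / 3) *
          Real.exp ζ.re ^ 4) := by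
    intro N k ζ hζ
    have hgd : Differentiable ℂ fun z => h z * T N z := hh.mul (hTd N)
    obtain ⟨R, hR⟩ := exists_one_le_norm_partial_genFun ε μ ν N
    -- `A₂` depends on `N`, but enters only the a priori growth and not the resulting bound.
    obtain ⟨A₂, hA₂, h2⟩ := exists_forall_norm_le_of_outside_ball hgd.continuous
      (s := Set.univ) (Φ := fun z => (1 + ‖z‖) ^ 2 * Real.exp (Real.pi / 2 * ‖z‖ ^ 2))
      (fun z _ => one_le_mul_of_one_le_of_one_le (one_le_pow₀ (by linarith [norm_nonneg z]))
        (Real.one_le_exp_iff.2 (by positivity))) (M := Cf) (R := R) (fun z _ hr => by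
        rw [← mul_assoc]
        refine le_trans ?_ (hf z)
        have h3 : f z = ((z - μ) * (z - ν) * ∏ n ∈ Finset.range N, nodeFactor ε n z) *
            (h z * T N z) := by
          rw [hfh, genFun, ← prod_range_mul_tprod (B := B) hu hK z N]; ring
        rw [h3, norm_mul ((z - μ) * (z - ν) * _)]
        exact le_mul_of_one_le_left (norm_nonneg (h z * T N z)) (hR z hr))
    obtain ⟨A₃, B₃, hB₃, h3⟩ := pow_mul_exp_growth hA₂ (b := Real.pi / 2) (by positivity) 2 (k := 2)
      (c := 5) (by norm_num) (by norm_num)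
    have h4 := norm_le_of_sector_growth
      (G := fun z => h (Complex.I ^ k * z) * T N (Complex.I ^ k * z))
      (hgd.comp (f := fun z : ℂ => Complex.I ^ k * z) (by fun_prop))
      (α := Real.pi / 12) (c := 5) (A := A₃) (B := B₃) (b := b) (C := A₁) (k := 4) (m := 3)
      (by positivity) (by linarith) (by rw [hα]; linarith)
      (by rw [lt_div_iff₀ (by positivity)]; linarith) (by norm_num) hB₃ (by positivity)
      (by positivity)
      (fun ζ _ => by
        refine (h2 _ (Set.mem_univ _)).trans ?_
        rw [norm_I_pow_mul_exp, ← mul_assoc]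
        exact h3 ζ.re)
      (fun ζ hζ => by
        rw [norm_mul]
        have h5 := hD _ (I_pow_mul_exp_mem_diagonalSector k hζ.ge (by rw [hζ]; linarith))
        have h6 := hTn N (Complex.I ^ k * Complex.exp ζ)
        rw [norm_I_pow_mul_exp] at h5 h6
        set r := Real.exp ζ.re with hr
        have hr0 : 0 < r := Real.exp_pos _
        have h7 := one_add_pow_four_le hr0.le
        have h8 : r ^ 2 - |((Complex.I ^ k * Complex.exp ζ) ^ 2).im| ≤ 1 + r ^ 4 := by
          have := abs_nonneg ((Complex.I ^ k * Complex.exp ζ) ^ 2).im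
          nlinarith [sq_nonneg (r ^ 2 - 1)]
        calc _ ≤ (A * ((1 + r) ^ 3 * Real.exp (Real.pi / 2 * (1 + r ^ 4)))) *
              Real.exp (s * (16 * (1 + r ^ 4))) := by
              refine mul_le_mul (h5.trans ?_) (h6.trans ?_) (norm_nonneg _) (by positivity)
              · gcongr
              · gcongr
          _ = A * (1 + r) ^ 3 * (Real.exp (Real.pi / 2 * (1 + r ^ 4)) *
              Real.exp (s * (16 * (1 + r ^ 4)))) := by ring
          _ = A * (1 + r) ^ 3 * (Real.exp b * Real.exp (b * r ^ 4)) := by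
              rw [← Real.exp_add, ← Real.exp_add]; congr 2; rw [hb]; ring
          _ = _ := by rw [hA₁]; ring) hζ
    rw [hα] at h4
    exact h4
  refine ⟨2 ^ 3 * A₁, b / Real.cos (Real.pi / 3), by positivity,
    div_nonneg (by positivity) (by rw [Real.cos_pi_div_three]; norm_num), fun k ζ hζ => ?_⟩
  have hlim : Tendsto (fun N => ‖h (Complex.I ^ k * Complex.exp ζ) *
      T N (Complex.I ^ k * Complex.exp ζ)‖) atTop (nhds ‖h (Complex.I ^ k * Complex.exp ζ)‖) := by
    have := ((hTlim (Complex.I ^ k * Complex.exp ζ)).const_mul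
      (h (Complex.I ^ k * Complex.exp ζ))).norm
    simpa using this
  exact le_of_tendsto hlim (Eventually.of_forall fun N => hbound N k ζ hζ)

/-- Second growth estimate for a quotient by the generating function: order two. -/
theorem exists_norm_quotient_le_exp_sq {h : ℂ → ℂ} (hh : Differentiable ℂ h)
    {A : ℝ} (hA : 0 ≤ A) (hD : ∀ z ∈ diagonalSector, ‖h z‖ ≤
      A * ((1 + ‖z‖) ^ 3 * Real.exp (Real.pi / 2 * (‖z‖ ^ 2 - |(z ^ 2).im|))))
    {A' b : ℝ} (hA' : 0 ≤ A') (hb : 0 ≤ b) (hs : ∀ (k : ℕ) (ζ : ℂ), |ζ.im| ≤ Real.pi / 12 →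
      ‖h (Complex.I ^ k * Complex.exp ζ)‖ ≤
        A' * (1 + Real.exp ζ.re) ^ 3 * Real.exp (b * Real.exp ζ.re ^ 4)) :
    ∃ A₂ b₂ : ℝ, 0 ≤ A₂ ∧ 0 ≤ b₂ ∧ ∀ (k : ℕ) (ζ : ℂ), |ζ.im| ≤ Real.pi / 4 →
      ‖h (Complex.I ^ k * Complex.exp ζ)‖ ≤
        A₂ * (1 + Real.exp ζ.re) ^ 3 * Real.exp (b₂ * Real.exp ζ.re ^ 2) := by
  have hpi := Real.pi_pos
  obtain ⟨A₃, B₃, hB₃, h3⟩ := pow_mul_exp_growth hA' hb 3 (k := 4) (c := 5) (by norm_num)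
    (by norm_num)
  have hα : ((2 : ℕ) : ℝ) * (Real.pi / 12) = Real.pi / 6 := by push_cast; ring
  have hcos := cos_pi_div_six_ge
  have hcos1 := Real.cos_le_one (Real.pi / 6)
  have hdiag : ∀ (k : ℕ) (ζ : ℂ), Real.pi / 12 ≤ |ζ.im| → |ζ.im| ≤ Real.pi / 4 →
      ‖h (Complex.I ^ k * Complex.exp ζ)‖ ≤
        A * (1 + Real.exp ζ.re) ^ 3 * Real.exp (Real.pi / 2 * Real.exp ζ.re ^ 2) := by
    intro k ζ h1 h2
    refine (hD _ (I_pow_mul_exp_mem_diagonalSector k h1 h2)).trans ?_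
    rw [norm_I_pow_mul_exp, ← mul_assoc]
    gcongr
    linarith [abs_nonneg ((Complex.I ^ k * Complex.exp ζ) ^ 2).im]
  refine ⟨2 ^ 3 * A, Real.pi / 2 / Real.cos (Real.pi / 6), by positivity, by positivity,
    fun k ζ hζ => ?_⟩
  by_cases hζ' : |ζ.im| ≤ Real.pi / 12
  -- Order four inside is admissible, the critical order being 6, and the boundary rays see only
  -- order two.
  · have h4 := norm_le_of_sector_growth (G := fun z => h (Complex.I ^ k * z))
      (hh.comp (f := fun z => Complex.I ^ k * z) (by fun_prop))
      (α := Real.pi / 12) (c := 5) (A := A₃) (B := B₃) (b := Real.pi / 2) (C := A) (k := 2) (m := 3)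
      (by positivity) (by linarith) (by rw [hα]; linarith)
      (by rw [lt_div_iff₀ (by positivity)]; linarith) (by norm_num) hB₃ (by positivity) hA
      (fun ζ hζ => (hs k ζ hζ).trans (h3 ζ.re))
      (fun ζ hζ => hdiag k ζ hζ.ge (by rw [hζ]; linarith)) hζ'
    rwa [hα] at h4
  · refine (hdiag k ζ (not_le.1 hζ').le hζ).trans ?_
    have h5 : Real.pi / 2 ≤ Real.pi / 2 / Real.cos (Real.pi / 6) := by
      rw [le_div_iff₀ (by linarith)]; nlinarith
    have h6 : A ≤ 2 ^ 3 * A := by linarith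
    gcongr

/-- By `(1 - sin) / cos = cos / (1 + sin)` the singularity at `π / 4` is removable. The function is
the rate that Phragmén–Lindelöf leaves in the sector of half-angle `α`. -/
theorem one_sub_sin_div_cos_tendsto :
    Tendsto (fun α : ℝ => Real.pi / 2 * (1 - Real.sin (2 * α)) / Real.cos (2 * α))
      (nhdsWithin (Real.pi / 4) (Set.Iio (Real.pi / 4))) (nhds 0) := by
  have h1 : Tendsto (fun α : ℝ => Real.pi / 2 * (Real.cos (2 * α) / (1 + Real.sin (2 * α))))
      (nhds (Real.pi / 4)) (nhds 0) := by
    have hs : Real.sin (2 * (Real.pi / 4)) = 1 := by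
      rw [show 2 * (Real.pi / 4) = Real.pi / 2 by ring, Real.sin_pi_div_two]
    have hc : Real.cos (2 * (Real.pi / 4)) = 0 := by
      rw [show 2 * (Real.pi / 4) = Real.pi / 2 by ring, Real.cos_pi_div_two]
    have : ContinuousAt (fun α : ℝ => Real.pi / 2 * (Real.cos (2 * α) / (1 + Real.sin (2 * α))))
        (Real.pi / 4) := by
      refine ContinuousAt.mul continuousAt_const (ContinuousAt.div (by fun_prop) (by fun_prop) ?_)
      rw [hs]; norm_num
    have h2 := this.tendsto
    rwa [hc, zero_div, mul_zero] at h2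
  refine (h1.mono_left nhdsWithin_le_nhds).congr' ?_
  have hpi := Real.pi_pos
  filter_upwards [Ioo_mem_nhdsLT (show (0:ℝ) < Real.pi / 4 by positivity)] with α hα
  have hc : 0 < Real.cos (2 * α) :=
    Real.cos_pos_of_mem_Ioo ⟨by linarith [hα.1], by linarith [hα.2]⟩
  have hs : 0 < Real.sin (2 * α) := Real.sin_pos_of_pos_of_lt_pi (by linarith [hα.1])
    (by linarith [hα.2])
  rw [mul_div_assoc]
  congr 1
  rw [div_eq_div_iff (by linarith) hc.ne']
  nlinarith [Real.sin_sq_add_cos_sq (2 * α)]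

/-- An entire function of order two whose growth near the diagonals is controlled by the
generating function has polynomial growth. -/
theorem norm_le_of_exp_sq_growth {h : ℂ → ℂ} (hh : Differentiable ℂ h)
    {A : ℝ} (hA : 0 ≤ A) (hD : ∀ z ∈ diagonalSector, ‖h z‖ ≤
      A * ((1 + ‖z‖) ^ 3 * Real.exp (Real.pi / 2 * (‖z‖ ^ 2 - |(z ^ 2).im|))))
    {A₂ b₂ : ℝ} (hA₂ : 0 ≤ A₂) (hb₂ : 0 ≤ b₂) (hs : ∀ (k : ℕ) (ζ : ℂ), |ζ.im| ≤ Real.pi / 4 →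
      ‖h (Complex.I ^ k * Complex.exp ζ)‖ ≤
        A₂ * (1 + Real.exp ζ.re) ^ 3 * Real.exp (b₂ * Real.exp ζ.re ^ 2)) (z : ℂ) :
    ‖h z‖ ≤ 2 ^ 3 * A * (1 + ‖z‖) ^ 3 := by
  have hpi := Real.pi_pos
  have hdiag : ∀ z ∈ diagonalSector, ‖z‖ ^ 2 ≤ |(z ^ 2).im| → ‖h z‖ ≤ 2 ^ 3 * A * (1 + ‖z‖) ^ 3 := by
    intro z hz hz'
    refine (hD z hz).trans ?_
    have h1 : Real.exp (Real.pi / 2 * (‖z‖ ^ 2 - |(z ^ 2).im|)) ≤ 1 :=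
      Real.exp_le_one_iff.2 (mul_nonpos_of_nonneg_of_nonpos (by positivity) (by linarith))
    calc _ ≤ A * ((1 + ‖z‖) ^ 3 * 1) := by gcongr
      _ ≤ _ := by
        have : 0 ≤ A * (1 + ‖z‖) ^ 3 := by positivity
        linarith
  rcases eq_or_ne z 0 with rfl | hz0
  · exact hdiag 0 (by change ‖(0:ℂ)‖ ^ 2 / 2 ≤ |((0:ℂ) ^ 2).im|; simp) (by simp)
  obtain ⟨k, ζ, hζ, rfl⟩ := exists_eq_I_pow_mul_exp hz0
  rcases hζ.lt_or_eq with hlt | heq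
  · rw [norm_I_pow_mul_exp]
    -- Order two is critical for half-angle `π / 4`, so a slightly smaller `α` is used. As `α`
    -- increases to `π / 4` the exponential rate tends to 0, and the other constants do not depend
    -- on `α`.
    have hlim : Tendsto (fun α : ℝ => 2 ^ 3 * A * (1 + Real.exp ζ.re) ^ 3 *
        Real.exp (Real.pi / 2 * (1 - Real.sin (2 * α)) / Real.cos (2 * α) * Real.exp ζ.re ^ 2))
        (nhdsWithin (Real.pi / 4) (Set.Iio (Real.pi / 4)))
        (nhds (2 ^ 3 * A * (1 + Real.exp ζ.re) ^ 3)) := by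
      have := ((one_sub_sin_div_cos_tendsto.mul_const (Real.exp ζ.re ^ 2)).rexp).const_mul
        (2 ^ 3 * A * (1 + Real.exp ζ.re) ^ 3)
      simpa using this
    refine ge_of_tendsto hlim ?_
    filter_upwards [Ioo_mem_nhdsLT (show Real.pi / 12 < Real.pi / 4 by linarith),
      Ioo_mem_nhdsLT hlt] with α hα hα2
    have hα0 : 0 < α := by linarith [hα.1]
    have hα4 : α < Real.pi / 4 := hα.2
    have hquot : 2 < Real.pi / (2 * α) := by
      rw [lt_div_iff₀ (by positivity)]; linarith
    -- The order `c` is the midpoint between 2 and the critical order `π / (2 α)`.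
    obtain ⟨A₃, B₃, hB₃, h3⟩ := pow_mul_exp_growth hA₂ hb₂ 3 (k := 2)
      (c := (2 + Real.pi / (2 * α)) / 2) (by norm_num) (by push_cast; linarith)
    have h4 := norm_le_of_sector_growth (G := fun z => h (Complex.I ^ k * z))
      (hh.comp (f := fun z => Complex.I ^ k * z) (by fun_prop))
      (α := α) (c := (2 + Real.pi / (2 * α)) / 2) (A := A₃) (B := B₃)
      (b := Real.pi / 2 * (1 - Real.sin (2 * α))) (C := A) (k := 2) (m := 3)
      hα0 (by linarith) (by push_cast; linarith)
      (by linarith) (by linarith) hB₃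
      (mul_nonneg (by positivity) (by linarith [Real.sin_le_one (2 * α)])) hA
      (fun ζ hζ => (hs k ζ (by linarith)).trans (h3 ζ.re))
      (fun ζ hζ => by
        refine (hD _ (I_pow_mul_exp_mem_diagonalSector k (by linarith [hα.1]) (by linarith))).trans ?_
        rw [norm_I_pow_mul_exp, abs_im_sq_I_pow_mul_exp, abs_sin_two_mul (by linarith), hζ,
          ← mul_assoc]
        apply le_of_eq
        congr 2; ring) hα2.1.le
    push_cast at h4
    exact h4
  · refine hdiag _ (I_pow_mul_exp_mem_diagonalSector k (by linarith) hζ) ?_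
    rw [norm_I_pow_mul_exp, abs_im_sq_I_pow_mul_exp, abs_sin_two_mul hζ, heq,
      show 2 * (Real.pi / 4) = Real.pi / 2 by ring, Real.sin_pi_div_two, mul_one]

/-- A quotient of a function of Fock growth by the generating function is a polynomial. -/
theorem exists_polynomial_quotient {ε : ℕ → Fin 4 → ℂ} {C : ℝ}
    (hε : ∀ n j, ‖ε n j‖ ≤ C / (n + 1)) {μ ν : ℂ} {f h : ℂ → ℂ} (hh : Differentiable ℂ h)
    (hfh : ∀ z, f z = genFun ε μ ν z * h z) {Cf : ℝ}
    (hf : ∀ z, ‖f z‖ ≤ Cf * (1 + ‖z‖) ^ 2 * Real.exp (Real.pi / 2 * ‖z‖ ^ 2))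
    {M R t : ℝ} (hM : 0 < M) (ht0 : 0 ≤ t) (ht : t ≤ 1)
    (hS : ∀ z ∈ diagonalSector, R ≤ ‖z‖ →
      Real.exp (Real.pi / 2 * |(z ^ 2).im|) ≤ M * ‖z‖ ^ t * ‖genFun ε μ ν z‖) :
    ∃ P : Polynomial ℂ, ∀ z, h z = P.eval z := by
  have hpi := Real.pi_pos
  obtain ⟨A, hA, hD⟩ := exists_forall_norm_le_of_outside_ball hh.continuous (s := diagonalSector)
    (Φ := fun z => (1 + ‖z‖) ^ 3 * Real.exp (Real.pi / 2 * (‖z‖ ^ 2 - |(z ^ 2).im|)))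
    (fun z _ => one_le_mul_of_one_le_of_one_le (one_le_pow₀ (by linarith [norm_nonneg z]))
      (Real.one_le_exp_iff.2 (mul_nonneg (by positivity) (by linarith [abs_im_sq_le z]))))
    (M := M * Cf) (R := R) (fun z hz hr => by
      have h1 := hS z hz hr
      rw [mul_sub, Real.exp_sub, ← mul_div_assoc, ← mul_div_assoc, le_div_iff₀ (Real.exp_pos _)]
      have h2 := rpow_le_one_add (norm_nonneg z) ht0 ht
      calc ‖h z‖ * Real.exp (Real.pi / 2 * |(z ^ 2).im|)
          ≤ ‖h z‖ * (M * ‖z‖ ^ t * ‖genFun ε μ ν z‖) := by gcongr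
        _ = M * ‖z‖ ^ t * ‖f z‖ := by rw [hfh, norm_mul]; ring
        _ ≤ M * (1 + ‖z‖) * (Cf * (1 + ‖z‖) ^ 2 * Real.exp (Real.pi / 2 * ‖z‖ ^ 2)) := by
            gcongr
            exact hf z
        _ = _ := by ring)
  obtain ⟨A', b, hA', hb, h4⟩ := exists_norm_quotient_le_exp_pow_four hε hh hfh hf hA hD
  obtain ⟨A₂, b₂, hA₂, hb₂, h5⟩ := exists_norm_quotient_le_exp_sq hh hA hD hA' hb h4
  exact exists_polynomial_of_norm_le hh (norm_le_of_exp_sq_growth hh hA hD hA₂ hb₂ h5)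

/-! ### Integrability along the diagonals. -/

/-- The source of the Gaussian decay transversal to the diagonals. -/
theorem sq_norm_sub_abs_im_sq (z : ℂ) :
    ‖z‖ ^ 2 - |(z ^ 2).im| = (|z.re| - |z.im|) ^ 2 := by
  have h2 : (z ^ 2).im = 2 * (z.re * z.im) := by rw [pow_two, Complex.mul_im]; ring
  rw [h2, abs_mul, abs_mul, abs_two, Complex.sq_norm, Complex.normSq_apply, sub_sq, sq_abs, sq_abs]
  ring

theorem lintegral_complex_eq_prod {F : ℂ → ENNReal} (hF : Measurable F) :
    ∫⁻ z, F z = ∫⁻ x : ℝ, ∫⁻ y : ℝ, F ⟨x, y⟩ := by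
  rw [← (Complex.volume_preserving_equiv_real_prod.symm).lintegral_comp_emb
    Complex.measurableEquivRealProd.symm.measurableEmbedding, Measure.volume_eq_prod,
    lintegral_prod]
  · rfl
  · exact (hF.comp Complex.measurableEquivRealProd.symm.measurable).aemeasurable

/-- Integrability of a function concentrated near the diagonals. -/
theorem lintegral_diagonal_lt_top {s c : ℝ} (hs : 1 < s) (hc : 0 < c) :
    ∫⁻ z : ℂ, ENNReal.ofReal ((1 + ‖z‖) ^ (-s) * Real.exp (-c * (‖z‖ ^ 2 - |(z ^ 2).im|))) < ⊤ := by
  have hmeas : Measurable fun z : ℂ => ENNReal.ofReal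
      ((1 + ‖z‖) ^ (-s) * Real.exp (-c * (‖z‖ ^ 2 - |(z ^ 2).im|))) := by fun_prop
  rw [lintegral_complex_eq_prod hmeas]
  have hg : Integrable fun t : ℝ => Real.exp (-c * t ^ 2) := integrable_exp_neg_mul_sq hc
  set I : ENNReal := ∫⁻ t : ℝ, ENNReal.ofReal (Real.exp (-c * t ^ 2)) with hI
  have hIfin : I < ⊤ := hg.lintegral_lt_top
  have hj : Integrable fun x : ℝ => (1 + ‖x‖) ^ (-s) := integrable_one_add_norm (by simpa using hs)
  have hJfin : ∫⁻ x : ℝ, ENNReal.ofReal ((1 + ‖x‖) ^ (-s)) < ⊤ := hj.lintegral_lt_top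
  -- For fixed `x` the integrand is dominated by Gaussians in `y` centred at `x` and `-x`, whose
  -- integrals do not depend on `x`.
  calc _ ≤ ∫⁻ x : ℝ, ENNReal.ofReal ((1 + ‖x‖) ^ (-s)) * (I + I) := by
        refine lintegral_mono fun x => ?_
        have h1 : ∀ y : ℝ, ENNReal.ofReal ((1 + ‖(⟨x, y⟩ : ℂ)‖) ^ (-s) *
            Real.exp (-c * (‖(⟨x, y⟩ : ℂ)‖ ^ 2 - |((⟨x, y⟩ : ℂ) ^ 2).im|))) ≤
            ENNReal.ofReal ((1 + ‖x‖) ^ (-s)) * (ENNReal.ofReal (Real.exp (-c * (y - x) ^ 2)) +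
              ENNReal.ofReal (Real.exp (-c * (y + x) ^ 2))) := by
          intro y
          rw [← ENNReal.ofReal_add (Real.exp_pos _).le (Real.exp_pos _).le,
            ← ENNReal.ofReal_mul (by positivity)]
          apply ENNReal.ofReal_le_ofReal
          rw [sq_norm_sub_abs_im_sq]
          have hx : ‖x‖ ≤ ‖(⟨x, y⟩ : ℂ)‖ := Complex.abs_re_le_norm ⟨x, y⟩
          have h2 : (1 + ‖(⟨x, y⟩ : ℂ)‖) ^ (-s) ≤ (1 + ‖x‖) ^ (-s) :=
            Real.rpow_le_rpow_of_nonpos (by positivity) (by linarith) (by linarith)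
          have h3 : Real.exp (-c * (|x| - |y|) ^ 2) ≤
              Real.exp (-c * (y - x) ^ 2) + Real.exp (-c * (y + x) ^ 2) := by
            have e1 := Real.exp_pos (-c * (y - x) ^ 2)
            have e2 := Real.exp_pos (-c * (y + x) ^ 2)
            rcases abs_cases x with ⟨ha, _⟩ | ⟨ha, _⟩ <;>
              rcases abs_cases y with ⟨hb, _⟩ | ⟨hb, _⟩ <;> rw [ha, hb]
            · rw [show (x - y) ^ 2 = (y - x) ^ 2 by ring]; linarith
            · rw [show (x - -y) ^ 2 = (y + x) ^ 2 by ring]; linarith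
            · rw [show (-x - y) ^ 2 = (y + x) ^ 2 by ring]; linarith
            · rw [show (-x - -y) ^ 2 = (y - x) ^ 2 by ring]; linarith
          exact mul_le_mul h2 h3 (Real.exp_pos _).le (by positivity)
        refine (lintegral_mono h1).trans ?_
        rw [lintegral_const_mul' _ _ ENNReal.ofReal_ne_top, lintegral_add_left (by fun_prop)]
        gcongr
        · exact (lintegral_sub_right_eq_self
            (fun t : ℝ => ENNReal.ofReal (Real.exp (-c * t ^ 2))) x).le
        · exact (lintegral_add_right_eq_self
            (fun t : ℝ => ENNReal.ofReal (Real.exp (-c * t ^ 2))) x).le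
    _ = (∫⁻ x : ℝ, ENNReal.ofReal ((1 + ‖x‖) ^ (-s))) * (I + I) :=
        lintegral_mul_const' _ _ (ENNReal.add_ne_top.2 ⟨hIfin.ne, hIfin.ne⟩)
    _ < ⊤ := ENNReal.mul_lt_top hJfin (ENNReal.add_lt_top.2 ⟨hIfin, hIfin⟩)

theorem memFock_of_norm_le {p : ℝ} (hp : 0 < p) {f : ℂ → ℂ} (hf : Differentiable ℂ f) {C s c : ℝ}
    (hC : 0 ≤ C) (hs : 1 < s * p) (hc : 0 < c)
    (h : ∀ z, ‖f z‖ * Real.exp (-(Real.pi / 2) * ‖z‖ ^ 2) ≤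
      C * ((1 + ‖z‖) ^ (-s) * Real.exp (-c * (‖z‖ ^ 2 - |(z ^ 2).im|)))) : MemFock p f := by
  rw [memFock_iff hp]
  refine ⟨hf, ?_⟩
  have h1 := lintegral_diagonal_lt_top hs (mul_pos hc hp)
  calc _ ≤ ∫⁻ z : ℂ, ENNReal.ofReal (C ^ p) * ENNReal.ofReal ((1 + ‖z‖) ^ (-(s * p)) *
        Real.exp (-(c * p) * (‖z‖ ^ 2 - |(z ^ 2).im|))) := by
        refine lintegral_mono fun z => ?_
        dsimp only
        rw [ENNReal.ofReal_rpow_of_nonneg (by positivity) hp.le, ← ENNReal.ofReal_mul (by positivity)]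
        apply ENNReal.ofReal_le_ofReal
        refine (Real.rpow_le_rpow (by positivity) (h z) hp.le).trans (le_of_eq ?_)
        rw [Real.mul_rpow hC (by positivity), Real.mul_rpow (by positivity) (by positivity),
          ← Real.rpow_mul (by positivity), ← Real.exp_mul]
        congr 3 <;> ring
    _ = ENNReal.ofReal (C ^ p) * _ := lintegral_const_mul' _ _ ENNReal.ofReal_ne_top
    _ < ⊤ := ENNReal.mul_lt_top ENNReal.ofReal_lt_top h1

/-- A function which is large near the diagonals is not in the Fock space. -/
theorem not_memFock_of_le_norm {p : ℝ} (hp : 0 < p) {f : ℂ → ℂ} {c R t : ℝ} (hc : 0 < c)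
    (ht0 : 0 ≤ t) (ht : t * p ≤ 1)
    (h : ∀ z ∈ diagonalSector, R ≤ ‖z‖ →
      c * (‖z‖ ^ (-t) * Real.exp (Real.pi / 2 * |(z ^ 2).im|)) ≤ ‖f z‖) : ¬ MemFock p f := by
  intro hf
  rw [memFock_iff hp] at hf
  obtain ⟨hd, hI⟩ := hf
  have hcont := hd.continuous
  have hmeas : Measurable fun z => ENNReal.ofReal
      (‖f z‖ * Real.exp (-(Real.pi / 2) * ‖z‖ ^ 2)) ^ p := by
    have := hcont.norm.measurable
    fun_prop
  rw [lintegral_complex_eq_prod hmeas] at hI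
  set X := max R 1 with hX
  have hX1 : 1 ≤ X := le_max_right _ _
  set c' : ℝ := (c * 3 ^ (-t) * Real.exp (-(Real.pi / 2))) ^ p with hc'
  have hc'0 : 0 < c' := by positivity
  -- On the band `x ≤ y ≤ x + 1` the transversal decay costs at most `exp (-π / 2)`. The band has
  -- unit width, so what remains is the integral of `x ^ (-(t p))`, divergent for `t p ≤ 1`.
  have hpt : ∀ x ∈ Set.Ioi X, ∀ y ∈ Set.Icc x (x + 1),
      ENNReal.ofReal (c' * x ^ (-(t * p))) ≤ ENNReal.ofReal
        (‖f ⟨x, y⟩‖ * Real.exp (-(Real.pi / 2) * ‖(⟨x, y⟩ : ℂ)‖ ^ 2)) ^ p := by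
    intro x hx y hy
    have hx1 : 1 < x := hX1.trans_lt hx
    have hxR : R ≤ x := (le_max_left _ _).trans (le_of_lt hx)
    set z : ℂ := ⟨x, y⟩ with hz
    have hzre : z.re = x := rfl
    have hzim : z.im = y := rfl
    have hsub := sq_norm_sub_abs_im_sq z
    have hax : |x| = x := abs_of_pos (by linarith)
    have hay : |y| = y := abs_of_pos (by linarith [hy.1])
    rw [hzre, hzim, hax, hay] at hsub
    have hsub1 : (x - y) ^ 2 ≤ 1 := by nlinarith [hy.1, hy.2]
    have hnx : x ≤ ‖z‖ := (le_abs_self x).trans (Complex.abs_re_le_norm z)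
    have hn3 : ‖z‖ ≤ 3 * x := by
      refine (Complex.norm_le_abs_re_add_abs_im z).trans ?_
      rw [hzre, hzim, hax, hay]
      linarith [hy.2]
    have hzD : z ∈ diagonalSector := by
      change ‖z‖ ^ 2 / 2 ≤ |(z ^ 2).im|
      have hn : ‖z‖ ^ 2 = x ^ 2 + y ^ 2 := by
        rw [Complex.sq_norm, Complex.normSq_apply, hzre, hzim]; ring
      nlinarith [hy.1, hy.2]
    have h1 := h z hzD (hxR.trans hnx)
    rw [ENNReal.ofReal_rpow_of_nonneg (by positivity) hp.le]
    apply ENNReal.ofReal_le_ofReal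
    have h2 : c * 3 ^ (-t) * Real.exp (-(Real.pi / 2)) * x ^ (-t) ≤
        ‖f z‖ * Real.exp (-(Real.pi / 2) * ‖z‖ ^ 2) := by
      have h3 : (3 * x) ^ (-t) ≤ ‖z‖ ^ (-t) :=
        Real.rpow_le_rpow_of_nonpos (by linarith) hn3 (by linarith)
      rw [Real.mul_rpow (by norm_num) (by linarith)] at h3
      have h4 : Real.exp (-(Real.pi / 2)) ≤
          Real.exp (Real.pi / 2 * |(z ^ 2).im|) * Real.exp (-(Real.pi / 2) * ‖z‖ ^ 2) := by
        rw [← Real.exp_add]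
        apply Real.exp_le_exp.2
        nlinarith [Real.pi_pos]
      calc _ = c * (3 ^ (-t) * x ^ (-t)) * Real.exp (-(Real.pi / 2)) := by ring
        _ ≤ c * ‖z‖ ^ (-t) * (Real.exp (Real.pi / 2 * |(z ^ 2).im|) *
            Real.exp (-(Real.pi / 2) * ‖z‖ ^ 2)) := by gcongr
        _ = c * (‖z‖ ^ (-t) * Real.exp (Real.pi / 2 * |(z ^ 2).im|)) *
            Real.exp (-(Real.pi / 2) * ‖z‖ ^ 2) := by ring
        _ ≤ _ := by gcongr
    refine le_trans (le_of_eq ?_) (Real.rpow_le_rpow (by positivity) h2 hp.le)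
    rw [Real.mul_rpow (by positivity) (by positivity), ← Real.rpow_mul (by linarith), hc']
    congr 2; ring
  have hlow : ∫⁻ x in Set.Ioi X, ENNReal.ofReal (c' * x ^ (-(t * p))) < ⊤ := by
    refine lt_of_le_of_lt ?_ hI
    refine le_trans ?_ (setLIntegral_le_lintegral (Set.Ioi X) _)
    refine setLIntegral_mono' measurableSet_Ioi fun x hx => ?_
    refine le_trans ?_ (setLIntegral_le_lintegral (Set.Icc x (x + 1)) _)
    refine le_trans (le_of_eq ?_) (setLIntegral_mono' measurableSet_Icc (hpt x hx))
    rw [setLIntegral_const, Real.volume_Icc]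
    simp
  have hint : IntegrableOn (fun x : ℝ => x ^ (-(t * p))) (Set.Ioi X) := by
    refine ⟨Measurable.aestronglyMeasurable (by fun_prop), ?_⟩
    rw [hasFiniteIntegral_iff_ofReal]
    · have h5 : ∫⁻ x in Set.Ioi X, ENNReal.ofReal (c' * x ^ (-(t * p))) =
          ENNReal.ofReal c' * ∫⁻ x in Set.Ioi X, ENNReal.ofReal (x ^ (-(t * p))) := by
        rw [← lintegral_const_mul' _ _ ENNReal.ofReal_ne_top]
        simp_rw [ENNReal.ofReal_mul hc'0.le]
      rw [h5] at hlow
      exact ENNReal.lt_top_of_mul_ne_top_right hlow.ne (by simpa using hc'0)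
    · filter_upwards [ae_restrict_mem measurableSet_Ioi] with x hx
      have : 0 < x := by linarith [Set.mem_Ioi.1 hx]
      positivity
  rw [integrableOn_Ioi_rpow_iff (by linarith)] at hint
  linarith

/-! ### Zero excess and uniqueness for the generating function. -/

/-- Removing one zero from the generating function gives a function in the Fock space. -/
theorem memFock_dslope_genFun {p : ℝ} (hp : 0 < p) {ε : ℕ → Fin 4 → ℂ} {C : ℝ}
    (hε : ∀ n j, ‖ε n j‖ ≤ C / (n + 1)) {μ ν w : ℂ} {M R t : ℝ} (hM : 0 < M) (ht0 : 0 ≤ t)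
    (ht : t ≤ 1) (htp : 1 < (1 - t) * p) (hS : ∀ z ∈ diagonalSector, R ≤ ‖z‖ →
      ‖genFun ε μ ν z‖ ≤ M * ‖z‖ ^ t * Real.exp (Real.pi / 2 * |(z ^ 2).im|))
    (hd : Differentiable ℂ (dslope (genFun ε μ ν) w))
    (hmul : ∀ z, genFun ε μ ν z = (z - w) * dslope (genFun ε μ ν) w z) :
    MemFock p (dslope (genFun ε μ ν) w) := by
  have hpi := Real.pi_pos
  have hpi3 := Real.pi_gt_three
  obtain ⟨A, hA, hsec⟩ := exists_norm_genFun_le_sector hε μ ν hM ht0 ht hS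
  set f := dslope (genFun ε μ ν) w with hf
  -- Near the axes the spare decay rate is `π / 2 - 3 π / 10 = π / 5`; half of it absorbs the
  -- polynomial factors and the other half, `π / 10`, stays in `Ψ`.
  set Ψ : ℂ → ℝ := fun z => (1 + ‖z‖) ^ (-(1 - t)) *
    Real.exp (-(Real.pi / 10) * (‖z‖ ^ 2 - |(z ^ 2).im|)) with hΨ
  have hΨ0 : ∀ z, 0 < Ψ z := fun z => by simp only [hΨ]; positivity
  have hout : ∀ z : ℂ, max R (2 * ‖w‖ + 2) ≤ ‖z‖ →
      ‖f z‖ * Real.exp (-(Real.pi / 2) * ‖z‖ ^ 2) ≤ (4 * M + 8 * A) * Ψ z := by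
    intro z hz
    have hzR : R ≤ ‖z‖ := (le_max_left _ _).trans hz
    have hzw : 2 * ‖w‖ + 2 ≤ ‖z‖ := (le_max_right _ _).trans hz
    have hw0 := norm_nonneg w
    have hsub : ‖z‖ / 2 ≤ ‖z - w‖ := by linarith [norm_sub_norm_le z w]
    have hSf : ‖genFun ε μ ν z‖ = ‖z - w‖ * ‖f z‖ := by rw [hmul, norm_mul]
    set r := ‖z‖ with hr
    have hr1 : 1 ≤ r := by linarith
    have him : 0 ≤ r ^ 2 - |(z ^ 2).im| := by linarith [abs_im_sq_le z]
    have him' : r ^ 2 - |(z ^ 2).im| ≤ r ^ 2 := by linarith [abs_nonneg (z ^ 2).im]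
    have hz0 : z ≠ 0 := by rw [← norm_pos_iff]; linarith
    obtain ⟨k, ζ, hζ, hzζ⟩ := exists_eq_I_pow_mul_exp hz0
    have hrζ : Real.exp ζ.re = r := by rw [hr, hzζ, norm_I_pow_mul_exp]
    by_cases hζ' : |ζ.im| ≤ Real.pi / 12
    · have h1 := hsec k ζ hζ'
      rw [← hzζ, hrζ] at h1
      have h2 : ‖f z‖ ≤ A * (1 + r) * Real.exp (3 / 10 * Real.pi * r ^ 2) := by
        refine le_trans ?_ h1
        rw [hSf]
        exact le_mul_of_one_le_left (norm_nonneg _) (by linarith)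
      have h3 : (1 + r) ≤ (1 + r) ^ (-(1 - t)) * (8 * Real.exp (Real.pi / 10 * r ^ 2)) := by
        have h4 : (1 + r) * (1 + r) ^ (1 - t) ≤ 8 * Real.exp (Real.pi / 10 * r ^ 2) := by
          have h5 : (1 + r) ^ (1 - t) ≤ 1 + r := by
            calc _ ≤ (1 + r) ^ (1 : ℝ) :=
                  Real.rpow_le_rpow_of_exponent_le (by linarith) (by linarith)
              _ = _ := Real.rpow_one _
          have h6 := Real.add_one_le_exp (Real.pi / 10 * r ^ 2)
          calc _ ≤ (1 + r) * (1 + r) := by gcongr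
            _ ≤ 8 * (Real.pi / 10 * r ^ 2 + 1) := by nlinarith [sq_nonneg (r - 1), sq_nonneg r]
            _ ≤ _ := by gcongr
        rw [Real.rpow_neg (by linarith), ← div_eq_inv_mul, le_div_iff₀ (by positivity)]
        exact h4
      calc _ ≤ A * (1 + r) * Real.exp (3 / 10 * Real.pi * r ^ 2) *
            Real.exp (-(Real.pi / 2) * r ^ 2) := by gcongr
        _ ≤ A * ((1 + r) ^ (-(1 - t)) * (8 * Real.exp (Real.pi / 10 * r ^ 2))) *
            Real.exp (3 / 10 * Real.pi * r ^ 2) * Real.exp (-(Real.pi / 2) * r ^ 2) := by gcongr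
        _ = 8 * A * ((1 + r) ^ (-(1 - t)) * (Real.exp (Real.pi / 10 * r ^ 2) *
            Real.exp (3 / 10 * Real.pi * r ^ 2) * Real.exp (-(Real.pi / 2) * r ^ 2))) := by ring
        _ = 8 * A * ((1 + r) ^ (-(1 - t)) * Real.exp (-(Real.pi / 10) * r ^ 2)) := by
            rw [← Real.exp_add, ← Real.exp_add]; congr 3; ring
        _ ≤ 8 * A * Ψ z := by
            simp only [hΨ, ← hr]
            gcongr 8 * A * (_ * Real.exp ?_)
            nlinarith
        _ ≤ _ := by
            have := (hΨ0 z).le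
            gcongr; linarith
    · have hzD : z ∈ diagonalSector := by
        rw [hzζ]; exact I_pow_mul_exp_mem_diagonalSector k (not_le.1 hζ').le hζ
      have h1 := hS z hzD hzR
      have h2 : ‖f z‖ ≤ 2 * M * r ^ (-(1 - t)) * Real.exp (Real.pi / 2 * |(z ^ 2).im|) := by
        have h3 : r / 2 * ‖f z‖ ≤ M * r ^ t * Real.exp (Real.pi / 2 * |(z ^ 2).im|) := by
          refine le_trans ?_ h1
          rw [hSf]; gcongr
        have h4 : r ^ (-(1 - t)) * r = r ^ t := by
          have := Real.rpow_add_one (x := r) (by linarith) (-(1 - t))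
          rw [← this]; congr 1; ring
        rw [← h4] at h3
        have hr0 : 0 < r / 2 := by linarith
        refine le_of_mul_le_mul_left (h3.trans (le_of_eq ?_)) hr0
        ring
      have h5 : r ^ (-(1 - t)) ≤ 2 * (1 + r) ^ (-(1 - t)) := by
        have h6 : (2 * r) ^ (-(1 - t)) ≤ (1 + r) ^ (-(1 - t)) :=
          Real.rpow_le_rpow_of_nonpos (by linarith) (by linarith) (by linarith)
        have h7 : r ^ (-(1 - t)) = 2 ^ (1 - t) * (2 * r) ^ (-(1 - t)) := by
          rw [Real.mul_rpow (by norm_num) (by linarith), ← mul_assoc,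
            ← Real.rpow_add (by norm_num)]
          simp
        have h8 : (2 : ℝ) ^ (1 - t) ≤ 2 := by
          calc _ ≤ (2 : ℝ) ^ (1 : ℝ) :=
                Real.rpow_le_rpow_of_exponent_le (by norm_num) (by linarith)
            _ = _ := Real.rpow_one _
        rw [h7]
        gcongr
      calc _ ≤ 2 * M * (2 * (1 + r) ^ (-(1 - t))) * Real.exp (Real.pi / 2 * |(z ^ 2).im|) *
            Real.exp (-(Real.pi / 2) * r ^ 2) := by
              gcongr
              refine h2.trans ?_
              gcongr
        _ = 4 * M * ((1 + r) ^ (-(1 - t)) * (Real.exp (Real.pi / 2 * |(z ^ 2).im|) *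
            Real.exp (-(Real.pi / 2) * r ^ 2))) := by ring
        _ ≤ 4 * M * Ψ z := by
            simp only [hΨ, ← hr]
            rw [← Real.exp_add]
            gcongr 4 * M * (_ * Real.exp ?_)
            nlinarith
        _ ≤ _ := by
            have := (hΨ0 z).le
            gcongr; linarith
  have hΨc : Continuous Ψ := by
    refine Continuous.mul (Continuous.rpow_const (by fun_prop) fun z => Or.inl ?_) (by fun_prop)
    have := norm_nonneg z; linarith
  -- Normalizing by `Ψ` gives a continuous function, so the disc left out by `hout` is covered by
  -- compactness.
  set G : ℂ → ℂ := fun z => f z * ((Real.exp (-(Real.pi / 2) * ‖z‖ ^ 2) / Ψ z : ℝ) : ℂ) with hG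
  have hGc : Continuous G := by
    refine hd.continuous.mul (Complex.continuous_ofReal.comp
      (Continuous.div (by fun_prop) hΨc fun z => (hΨ0 z).ne'))
  have hGn : ∀ z, ‖G z‖ = ‖f z‖ * Real.exp (-(Real.pi / 2) * ‖z‖ ^ 2) / Ψ z := by
    intro z
    have := hΨ0 z
    rw [hG]
    simp only
    rw [norm_mul, Complex.norm_real, Real.norm_of_nonneg (by positivity), mul_div_assoc]
  obtain ⟨K, hK0, hK⟩ := exists_forall_norm_le_of_outside_ball hGc (s := Set.univ)
    (Φ := fun _ => 1) (fun _ _ => le_rfl) (M := 4 * M + 8 * A) (R := max R (2 * ‖w‖ + 2))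
    fun z _ hz => by
      rw [hGn, mul_one, div_le_iff₀ (hΨ0 z)]
      exact hout z hz
  refine memFock_of_norm_le hp hd (C := K) (s := 1 - t) (c := Real.pi / 10) hK0 htp (by positivity)
    fun z => ?_
  have := hK z (Set.mem_univ _)
  rwa [hGn, mul_one, div_le_iff₀ (hΨ0 z)] at this

theorem exists_le_norm_eval {P : Polynomial ℂ} (hP : P ≠ 0) :
    ∃ c R : ℝ, 0 < c ∧ ∀ z : ℂ, R ≤ ‖z‖ → c ≤ ‖P.eval z‖ := by
  by_cases hdeg : 0 < P.degree
  · have h1 := P.tendsto_norm_atTop hdeg (l := atTop.comap (norm : ℂ → ℝ)) (z := id) tendsto_comap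
    have h2 := eventually_comap.1 (h1.eventually_ge_atTop 1)
    obtain ⟨R, hR⟩ := eventually_atTop.1 h2
    exact ⟨1, R, one_pos, fun z hz => hR _ hz z rfl⟩
  · rw [Polynomial.eq_C_of_degree_le_zero (not_lt.1 hdeg)] at hP ⊢
    refine ⟨‖P.coeff 0‖, 0, norm_pos_iff.2 fun h => hP (by simp [h]), fun z _ => ?_⟩
    rw [Polynomial.eval_C]

/-- The zero set of the generating function is a uniqueness set. -/
theorem isFockUniquenessSet_of_genFun {p : ℝ} (hp : 1 < p) {ε : ℕ → Fin 4 → ℂ} {C : ℝ}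
    (hε : ∀ n j, ‖ε n j‖ ≤ C / (n + 1)) {μ ν : ℂ} {M R t : ℝ} (hM : 0 < M) (ht0 : 0 ≤ t)
    (ht : t ≤ 1) (htp : t * p ≤ 1) (hS : ∀ z ∈ diagonalSector, R ≤ ‖z‖ →
      Real.exp (Real.pi / 2 * |(z ^ 2).im|) ≤ M * ‖z‖ ^ t * ‖genFun ε μ ν z‖)
    (hord : ∀ z, genFun ε μ ν z = 0 → analyticOrderAt (genFun ε μ ν) z = 1) {f : ℂ → ℂ}
    (hf : MemFock p f) (hz : ∀ z, genFun ε μ ν z = 0 → f z = 0) : f = 0 := by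
  have hdS := differentiable_genFun hε μ ν
  obtain ⟨h, hh, hfh⟩ := exists_entire_mul_eq hf.1 hdS (fun z => by
    by_cases h0 : genFun ε μ ν z = 0
    · exact (hord z h0).le
    · rw [(hdS.analyticAt z).analyticOrderAt_eq_zero.2 h0]; exact zero_le_one) hz
  obtain ⟨Cf, -, hCf⟩ := hf.exists_norm_le hp
  obtain ⟨P, hP⟩ := exists_polynomial_quotient hε hh hfh hCf hM ht0 ht hS
  by_cases hP0 : P = 0
  · ext z
    simp [hfh, hP, hP0]
  -- A nonzero polynomial is bounded below far out, so `f` is at least a constant times the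
  -- generating function, which is too large along the diagonals.
  · exfalso
    obtain ⟨c, R', hc, hcR⟩ := exists_le_norm_eval hP0
    refine not_memFock_of_le_norm (p := p) (by linarith) (c := c / M) (R := max 1 (max R R'))
      (t := t) (by positivity) ht0 htp (fun z hzD hzR => ?_) hf
    have h1 : 1 ≤ ‖z‖ := (le_max_left _ _).trans hzR
    have h2 := hS z hzD ((le_max_left _ _).trans ((le_max_right _ _).trans hzR))
    have h3 := hcR z ((le_max_right _ _).trans ((le_max_right _ _).trans hzR))
    have hrt : 0 < ‖z‖ ^ t := Real.rpow_pos_of_pos (by linarith) t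
    rw [hfh, norm_mul, hP, Real.rpow_neg (norm_nonneg z)]
    calc c / M * ((‖z‖ ^ t)⁻¹ * Real.exp (Real.pi / 2 * |(z ^ 2).im|))
        ≤ c / M * ((‖z‖ ^ t)⁻¹ * (M * ‖z‖ ^ t * ‖genFun ε μ ν z‖)) := by gcongr
      _ = ‖genFun ε μ ν z‖ * c := by field_simp
      _ ≤ _ := by gcongr

/-! ### The sequence in indexed form, and the conclusion. -/

theorem alsNode_injective {n n' : ℕ} {j j' : Fin 4} (h : alsNode n j = alsNode n' j') :
    n = n' ∧ j = j' := by
  have h1 := congrArg norm h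
  rw [norm_alsNode, norm_alsNode] at h1
  have h2 := congrArg (· ^ 2) h1
  simp only [sqrt_two_mul_sq] at h2
  have h3 : (n : ℝ) = n' := by linarith
  have hn : n = n' := by exact_mod_cast h3
  subst hn
  refine ⟨rfl, ?_⟩
  have hs : ((Real.sqrt (2 * ((n : ℝ) + 1)) : ℝ) : ℂ) ≠ 0 := by
    exact_mod_cast (sqrt_two_mul_pos n).ne'
  have h4 : Complex.I ^ (j : ℕ) = Complex.I ^ (j' : ℕ) := mul_right_cancel₀ hs h
  have e3 : Complex.I ^ 3 = -Complex.I := Complex.I_pow_three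
  fin_cases j <;> fin_cases j' <;> simp [e3, Complex.ext_iff] at h4 ⊢ <;> norm_num at h4

theorem one_lt_norm_alsNode (n : ℕ) (j : Fin 4) : 1 < ‖alsNode n j‖ := by
  rw [norm_alsNode, Real.lt_sqrt (by norm_num)]
  linarith [n.cast_nonneg (α := ℝ)]

theorem mem_alsSet_iff {γ : ℂ} : γ ∈ alsSet ↔ γ = 1 ∨ γ = -1 ∨ ∃ n j, γ = alsNode n j := by
  have e0 : ∀ n, alsNode n 0 = (Real.sqrt (2 * ((n + 1 : ℕ) : ℝ)) : ℂ) := fun n => by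
    simp [alsNode]
  have e1 : ∀ n, alsNode n 1 = Complex.I * (Real.sqrt (2 * ((n + 1 : ℕ) : ℝ)) : ℂ) := fun n => by
    simp [alsNode]
  have e2 : ∀ n, alsNode n 2 = -(Real.sqrt (2 * ((n + 1 : ℕ) : ℝ)) : ℂ) := fun n => by
    simp [alsNode]
  have e3 : ∀ n, alsNode n 3 = -(Complex.I * (Real.sqrt (2 * ((n + 1 : ℕ) : ℝ)) : ℂ)) :=
    fun n => by
      have e3 : Complex.I ^ 3 = -Complex.I := Complex.I_pow_three
      simp [alsNode, e3]
  constructor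
  · rintro (⟨n, hn, h⟩ | h)
    · obtain ⟨m, rfl⟩ : ∃ m, n = m + 1 := ⟨n - 1, by omega⟩
      right; right
      rcases h with h | h | h | h
      · exact ⟨m, 0, h.trans (e0 m).symm⟩
      · exact ⟨m, 2, h.trans (e2 m).symm⟩
      · exact ⟨m, 1, h.trans (e1 m).symm⟩
      · exact ⟨m, 3, h.trans (e3 m).symm⟩
    · rcases h with h | h
      · exact Or.inl h
      · exact Or.inr (Or.inl h)
  · rintro (h | h | ⟨n, j, h⟩)
    · exact Or.inr (Or.inl h)
    · exact Or.inr (Or.inr h)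
    · refine Or.inl ⟨n + 1, by omega, ?_⟩
      fin_cases j
      · exact Or.inl (h.trans (e0 n))
      · exact Or.inr (Or.inr (Or.inl (h.trans (e1 n))))
      · exact Or.inr (Or.inl (h.trans (e2 n)))
      · exact Or.inr (Or.inr (Or.inr (h.trans (e3 n))))

/-- Nodes are indexed from 0 and `alsDelta` from 1, hence the shift. -/
theorem sum_alsNode_eq_alsDelta (δ : ℂ → ℝ) (n : ℕ) :
    ∑ j, δ (alsNode n j) = alsDelta δ (n + 1) := by
  have e3 : Complex.I ^ 3 = -Complex.I := Complex.I_pow_three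
  simp only [Fin.sum_univ_four, alsNode, alsDelta]
  simp [e3]
  ring

theorem sum_range_alsDelta (δ : ℂ → ℝ) (m : ℕ) :
    ∑ n ∈ Finset.range m, alsDelta δ (n + 1) = ∑ k ∈ Finset.Icc 1 m, alsDelta δ k := by
  rw [Finset.range_eq_Ico, Finset.sum_Ico_add' (fun k => alsDelta δ k) 0 m 1]
  rfl

theorem norm_le_div_of_norm_sq_mul_le {δ : ℂ → ℝ} {C : ℝ}
    (h : ∀ γ ∈ alsSet, ‖γ ^ 2 * (δ γ : ℂ)‖ ≤ C) (n : ℕ) (j : Fin 4) :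
    ‖(δ (alsNode n j) : ℂ)‖ ≤ C / (n + 1) := by
  have h1 := h (alsNode n j) (mem_alsSet_iff.2 (Or.inr (Or.inr ⟨n, j, rfl⟩)))
  rw [norm_mul, norm_pow, norm_alsNode, sqrt_two_mul_sq] at h1
  have hn : (0 : ℝ) < n + 1 := by positivity
  rw [le_div_iff₀ hn]
  have := norm_nonneg (δ (alsNode n j) : ℂ)
  nlinarith

/-- The complex perturbation exponents attached to `δ` and `θ`. -/
noncomputable def pertExponent (δ θ : ℂ → ℝ) (n : ℕ) (j : Fin 4) : ℂ :=
  (δ (alsNode n j) : ℂ) + Complex.I * (θ (alsNode n j) : ℂ)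

theorem perturbedPoint_alsNode (δ θ : ℂ → ℝ) (n : ℕ) (j : Fin 4) :
    perturbedPoint δ θ (alsNode n j) = pertNode (pertExponent δ θ) n j := by
  rw [perturbedPoint, pertNode, pertExponent, Complex.exp_add, mul_assoc]

/-- With the limsup taken in `EReal`, unbounded quotients are excluded by the hypothesis, and the
strict inequality leaves room for a real `b`. -/
theorem exists_lt_eventually_abs_sum_le {a : ℝ} {u : ℕ → ℝ}
    (h : limsup (fun n : ℕ => ((1 / Real.log n * |u n| : ℝ) : EReal)) atTop < (a : EReal)) :
    ∃ b : ℝ, 0 ≤ b ∧ b < a ∧ ∀ᶠ n : ℕ in atTop, |u n| ≤ b * Real.log n := by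
  obtain ⟨b, hb1, hb2⟩ := EReal.lt_iff_exists_real_btwn.1 h
  have hev : ∀ᶠ n : ℕ in atTop, |u n| ≤ b * Real.log n := by
    filter_upwards [eventually_lt_of_limsup_lt hb1, eventually_ge_atTop 2] with n hn hn2
    have hlog : 0 < Real.log n := Real.log_pos (by exact_mod_cast hn2)
    have h1 : 1 / Real.log n * |u n| < b := by exact_mod_cast hn
    rw [one_div, inv_mul_lt_iff₀ hlog] at h1
    linarith
  refine ⟨b, ?_, by exact_mod_cast hb2, hev⟩
  obtain ⟨n, hn, hn2⟩ := (hev.and (eventually_ge_atTop 2)).exists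
  have hlog : 0 < Real.log n := Real.log_pos (by exact_mod_cast hn2)
  have h0 : 0 ≤ b * Real.log n := (abs_nonneg _).trans hn
  exact nonneg_of_mul_nonneg_left h0 hlog

theorem theorem1p2 (p q : ℝ) (hp : 1 < p) (hpq : p.HolderConjugate q)
    (δ θ : ℂ → ℝ)
    (hsep : ∃ c : ℝ, 0 < c ∧ ∀ γ ∈ alsSet, ∀ γ' ∈ alsSet, γ ≠ γ' →
      c / min ‖γ‖ ‖γ'‖ ≤ ‖perturbedPoint δ θ γ - perturbedPoint δ θ γ'‖)
    (hδ : ∃ C : ℝ, ∀ γ ∈ alsSet, ‖γ ^ 2 * (δ γ : ℂ)‖ ≤ C)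
    (hθ : ∃ C : ℝ, ∀ γ ∈ alsSet, ‖γ ^ 2 * (θ γ : ℂ)‖ ≤ C)
    (hΔ : limsup (fun n : ℕ =>
        ((1 / Real.log n * |∑ k ∈ Finset.Icc 1 n, alsDelta δ k| : ℝ) : EReal)) atTop
      < ((1 / (2 * max p q) : ℝ) : EReal)) :
    IsFockUniquenessSetZeroExcess p (perturbedPoint δ θ '' alsSet) := by
  obtain ⟨c, hc, hsep⟩ := hsep
  obtain ⟨C₁, hC₁⟩ := hδ
  obtain ⟨C₂, hC₂⟩ := hθ
  set ε := pertExponent δ θ with hεdef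
  set μ := perturbedPoint δ θ 1 with hμdef
  set ν := perturbedPoint δ θ (-1) with hνdef
  have hε : ∀ n j, ‖ε n j‖ ≤ (C₁ + C₂) / (n + 1) := by
    intro n j
    rw [add_div]
    refine (norm_add_le _ _).trans (add_le_add (norm_le_div_of_norm_sq_mul_le hC₁ n j) ?_)
    rw [norm_mul, Complex.norm_I, one_mul]
    exact norm_le_div_of_norm_sq_mul_le hC₂ n j
  have hmem : ∀ n j, alsNode n j ∈ alsSet := fun n j =>
    mem_alsSet_iff.2 (Or.inr (Or.inr ⟨n, j, rfl⟩))
  have h1mem : (1 : ℂ) ∈ alsSet := mem_alsSet_iff.2 (Or.inl rfl)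
  have h2mem : (-1 : ℂ) ∈ alsSet := mem_alsSet_iff.2 (Or.inr (Or.inl rfl))
  have hne0 : ∀ γ ∈ alsSet, 0 < ‖γ‖ := by
    intro γ hγ
    rcases mem_alsSet_iff.1 hγ with rfl | rfl | ⟨n, j, rfl⟩
    · simp
    · simp
    · linarith [one_lt_norm_alsNode n j]
  -- Separation makes the perturbed points distinct, so that every zero of the generating function
  -- is simple.
  have hinj : ∀ γ ∈ alsSet, ∀ γ' ∈ alsSet, perturbedPoint δ θ γ = perturbedPoint δ θ γ' →
      γ = γ' := by
    intro γ hγ γ' hγ' h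
    by_contra hne
    have h1 := hsep γ hγ γ' hγ' hne
    rw [h, sub_self, norm_zero] at h1
    have h2 : 0 < c / min ‖γ‖ ‖γ'‖ := div_pos hc (lt_min (hne0 γ hγ) (hne0 γ' hγ'))
    linarith
  have hnode1 : ∀ n j, alsNode n j ≠ 1 := fun n j h => by
    have := one_lt_norm_alsNode n j
    rw [h] at this; simp at this
  have hnode2 : ∀ n j, alsNode n j ≠ -1 := fun n j h => by
    have := one_lt_norm_alsNode n j
    rw [h] at this; simp at this
  have hzero : ∀ z, genFun ε μ ν z = 0 ↔ z ∈ perturbedPoint δ θ '' alsSet := by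
    intro z
    rw [genFun_eq_zero_iff hε]
    constructor
    · rintro (rfl | rfl | ⟨n, j, rfl⟩)
      · exact ⟨1, h1mem, rfl⟩
      · exact ⟨-1, h2mem, rfl⟩
      · exact ⟨alsNode n j, hmem n j, perturbedPoint_alsNode δ θ n j⟩
    · rintro ⟨γ, hγ, rfl⟩
      rcases mem_alsSet_iff.1 hγ with rfl | rfl | ⟨n, j, rfl⟩
      · exact Or.inl rfl
      · exact Or.inr (Or.inl rfl)
      · exact Or.inr (Or.inr ⟨n, j, perturbedPoint_alsNode δ θ n j⟩)
  have hord : ∀ z, genFun ε μ ν z = 0 → analyticOrderAt (genFun ε μ ν) z = 1 := by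
    intro z hz
    refine analyticOrderAt_genFun hε (fun h => ?_) (fun n j h => ?_) (fun n j h => ?_)
      (fun n j n' j' h => ?_) hz
    · have := hinj 1 h1mem (-1) h2mem h
      norm_num [Complex.ext_iff] at this
    · rw [hεdef, ← perturbedPoint_alsNode] at h
      exact hnode1 n j (hinj _ (hmem n j) _ h1mem h)
    · rw [hεdef, ← perturbedPoint_alsNode] at h
      exact hnode2 n j (hinj _ (hmem n j) _ h2mem h)
    · rw [hεdef, ← perturbedPoint_alsNode, ← perturbedPoint_alsNode] at h
      exact alsNode_injective (hinj _ (hmem n j) _ (hmem n' j') h)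
  obtain ⟨b, hb0, hba, hb⟩ := exists_lt_eventually_abs_sum_le hΔ
  have hsum : ∀ m, ∑ n ∈ Finset.range m, ∑ j, (ε n j).re = ∑ k ∈ Finset.Icc 1 m, alsDelta δ k := by
    intro m
    rw [← sum_range_alsDelta]
    refine Finset.sum_congr rfl fun n _ => ?_
    rw [← sum_alsNode_eq_alsDelta]
    refine Finset.sum_congr rfl fun j _ => ?_
    simp [hεdef, pertExponent]
  obtain ⟨M, R, hM, hR, hS⟩ := exists_norm_genFun_bounds hε μ ν hb0 (hb.mono fun m hm => by
    rw [hsum]; exact hm)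
  have hp0 : 0 < p := by linarith
  have hq0 : 0 < q := hpq.symm.pos
  have hmax : 0 < max p q := lt_max_of_lt_left hp0
  have ht : 2 * b < 1 / max p q := by
    calc 2 * b < 2 * (1 / (2 * max p q)) := by linarith
      _ = 1 / max p q := by field_simp
  -- The exponent is `t = 2 b`. Comparison with `1 / p` gives `t p ≤ 1` for uniqueness; comparison
  -- with `1 / q = 1 - 1 / p` gives `1 < (1 - t) p` for the removal of a point.
  have htp : 2 * b < 1 / p := ht.trans_le (one_div_le_one_div_of_le hp0 (le_max_left _ _))
  have htq : 2 * b < 1 / q := ht.trans_le (one_div_le_one_div_of_le hq0 (le_max_right _ _))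
  have hconj : p⁻¹ + q⁻¹ = 1 := hpq.inv_add_inv_eq_one
  have hpinv : 0 < p⁻¹ := inv_pos.2 hp0
  have hpp : p⁻¹ * p = 1 := inv_mul_cancel₀ hp0.ne'
  rw [one_div] at htp htq
  have ht1 : 2 * b ≤ 1 := by linarith
  refine ⟨fun f hf hfz => ?_, fun w hw => ?_⟩
  · exact isFockUniquenessSet_of_genFun hp hε hM (by linarith) ht1 (by nlinarith)
      (fun z hz hzR => (hS z hz hzR).1) hord hf fun z hz => hfz z ((hzero z).1 hz)
  · obtain ⟨hd, hmul, hw0, hord'⟩ := dslope_zeros (differentiable_genFun hε μ ν) hord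
      ((hzero w).2 hw)
    refine ⟨dslope (genFun ε μ ν) w, ?_, fun h => hw0 (by rw [h]; rfl), ?_, ?_⟩
    · exact memFock_dslope_genFun hp0 hε hM (by linarith) ht1 (by nlinarith)
        (fun z hz hzR => (hS z hz hzR).2) hd hmul
    · rintro z ⟨hz, hzw⟩
      exact hord' z hzw ((hzero z).2 hz)
    · intro z hz h0
      by_cases hzw : z = w
      · rw [hzw] at h0; exact hw0 h0
      · exact hz ⟨(hzero z).1 (by rw [hmul, h0, mul_zero]), hzw⟩
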